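/- Let $X$ be a complex manifold of dimension $d$ with canonical bundle $K_X=\wedge^d T^*X$, and let $H$ be a complex Lie group. An $H$-character is a holomorphic homomorphism $\chi:H\to\mathbb{C}^\times$. For a holomorphic principal $H$-bundle $\pi:M\to X$ (with right action $(m,h)\mapsto mh$), a CY structure on $M$ is a nowhere vanishing holomorphic form $\omega$ of top degree on $M$ for which there is an $H$-character $\chi$ with $\Gamma_h\omega=\chi(h)\,\omega$ for all $h\in H$, where $\Gamma_h\omega=R_h^*\omega$ is the pullback of $\omega$ under $R_h:m\mapsto mh$. Let $M\times_H\mathbb{C}_\chi$ denote the holomorphic line bundle on $X$ which is the quotient of $M\times\mathbb{C}$ by $(m,v)\sim(mh^{-1},\chi(h)v)$. For a holomorphic line bundle $L$ on $X$, let $L^\times$ be the complement of the zero section of $L$, a principal $\mathbb{C}^\times$-bundle under scalar multiplication. All isomorphisms of line bundles are holomorphic. 1. A holomorphic principal $H$-bundle $M\to X$ admits a CY structure if and only if there is an $H$-character $\chi$ such that $K_X\cong M\times_H\mathbb{C}_\chi$. 2. For every holomorphic line bundle $L$ on $X$, $L^\times$ admits a CY structure if and only if $K_X\cong L^{\otimes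 l}$ for some $l\in\mathbb{Z}$. 3. A holomorphic principal $\mathbb{C}^\times$-bundle $M\to X$ admits a CY structure if and only if there is a holomorphic line bundle $L$ on $X$, with $K_X\cong L^{\otimes l}$ for some $l\in\mathbb{Z}$, such that $M$ is isomorphic to $L^\times$ over $X$ by a $\mathbb{C}^\times$-equivariant biholomorphic map. -/

import Mathlib

open Bundle Set Topology MulOpposite
open scoped Manifold ContDiff Bundle

universe uE uH uX uM v

noncomputable section

namespace CYBundle

/-! ## Holomorphic line bundles and their isomorphisms

Throughout, "holomorphic" is `ContMDiff _ _ ω` over `ℂ`. -/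

section LineBundles

variable {E : Type uE} [NormedAddCommGroup E] [NormedSpace ℂ E]
  {HX : Type uH} [TopologicalSpace HX]

/-- A holomorphic line bundle over the complex manifold `X` (with model `I`): a holomorphic vector
bundle with standard fibre `ℂ`. -/
structure HolomorphicLineBundle (I : ModelWithCorners ℂ E HX)
    (X : Type uX) [TopologicalSpace X] [ChartedSpace HX X] where
  /-- the fibre over a point -/
  Fiber : X → Type v
  [topFiber : ∀ x, TopologicalSpace (Fiber x)]
  [addFiber : ∀ x, AddCommGroup (Fiber x)]
  [modFiber : ∀ x, Module ℂ (Fiber x)]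
  [topTotal : TopologicalSpace (TotalSpace ℂ Fiber)]
  [fiberBundle : FiberBundle ℂ Fiber]
  [vectorBundle : VectorBundle ℂ ℂ Fiber]
  [holomorphic : ContMDiffVectorBundle ω ℂ Fiber I]

attribute [instance] HolomorphicLineBundle.topFiber HolomorphicLineBundle.addFiber
  HolomorphicLineBundle.modFiber HolomorphicLineBundle.topTotal
  HolomorphicLineBundle.fiberBundle HolomorphicLineBundle.vectorBundle
  HolomorphicLineBundle.holomorphic

/-- Two vector bundles over `X` are holomorphically isomorphic: there are linear isomorphisms
between corresponding fibres which, together with their inverses, form holomorphic maps of total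
spaces. -/
def HolomorphicallyIsomorphic (I : ModelWithCorners ℂ E HX)
    {X : Type*} [TopologicalSpace X] [ChartedSpace HX X]
    (F₁ : Type*) [NormedAddCommGroup F₁] [NormedSpace ℂ F₁] (V₁ : X → Type*)
    [∀ x, TopologicalSpace (V₁ x)] [∀ x, AddCommGroup (V₁ x)] [∀ x, Module ℂ (V₁ x)]
    [TopologicalSpace (TotalSpace F₁ V₁)] [FiberBundle F₁ V₁]
    (F₂ : Type*) [NormedAddCommGroup F₂] [NormedSpace ℂ F₂] (V₂ : X → Type*)
    [∀ x, TopologicalSpace (V₂ x)] [∀ x, AddCommGroup (V₂ x)] [∀ x, Module ℂ (V₂ x)]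
    [TopologicalSpace (TotalSpace F₂ V₂)] [FiberBundle F₂ V₂] : Prop :=
  ∃ Φ : ∀ x, V₁ x ≃ₗ[ℂ] V₂ x,
    ContMDiff (I.prod 𝓘(ℂ, F₁)) (I.prod 𝓘(ℂ, F₂)) ω
      (fun p : TotalSpace F₁ V₁ => (⟨p.1, Φ p.1 p.2⟩ : TotalSpace F₂ V₂)) ∧
    ContMDiff (I.prod 𝓘(ℂ, F₂)) (I.prod 𝓘(ℂ, F₁)) ω
      (fun p : TotalSpace F₂ V₂ => (⟨p.1, (Φ p.1).symm p.2⟩ : TotalSpace F₁ V₁))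

/-- The fibre at `x` of the canonical bundle `K_X = ⋀ᵈ T*X`, `d = dim X`: alternating `d`-forms on
the (holomorphic) tangent space. The topology on the total space and the local trivializations are
those induced from the tangent bundle. -/
abbrev CanonicalFiber (I : ModelWithCorners ℂ E HX)
    {X : Type*} [TopologicalSpace X] [ChartedSpace HX X] (x : X) : Type _ :=
  TangentSpace I x [⋀^Fin (Module.finrank ℂ E)]→L[ℂ] (Trivial X ℂ x)

/-- The standard fibre of the canonical bundle. -/
abbrev CanonicalModel (E : Type uE) [NormedAddCommGroup E] [NormedSpace ℂ E] : Type _ :=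
  E [⋀^Fin (Module.finrank ℂ E)]→L[ℂ] ℂ

/-- `K_X ≅ L` as holomorphic line bundles over `X`. -/
def CanonicalIso (I : ModelWithCorners ℂ E HX)
    {X : Type uX} [TopologicalSpace X] [ChartedSpace HX X] [IsManifold I ω X]
    (L : HolomorphicLineBundle.{uE, uH, uX, v} I X) : Prop :=
  HolomorphicallyIsomorphic I (CanonicalModel E) (fun x : X => CanonicalFiber I x) ℂ L.Fiber

namespace HolomorphicLineBundle

variable {I : ModelWithCorners ℂ E HX} {X : Type uX} [TopologicalSpace X] [ChartedSpace HX X]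
  (L : HolomorphicLineBundle.{uE, uH, uX, v} I X)

/-- The transition function `g_{ee'}` of `L` between two local trivializations: multiplication by
`g_{ee'}(x)` sends the `e`-coordinate of a vector of `L_x` to its `e'`-coordinate. -/
def transition (e e' : trivializationAtlas ℂ L.Fiber) (x : X) : ℂ :=
  haveI : MemTrivializationAtlas e.1 := ⟨e.2⟩
  haveI : MemTrivializationAtlas e'.1 := ⟨e'.2⟩
  e.1.coordChangeL ℂ e'.1 x 1

theorem transition_mul (e e' : trivializationAtlas ℂ L.Fiber) (x : X) (v : ℂ) :
    haveI : MemTrivializationAtlas e.1 := ⟨e.2⟩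
    haveI : MemTrivializationAtlas e'.1 := ⟨e'.2⟩
    e.1.coordChangeL ℂ e'.1 x v = L.transition e e' x * v := by
  have : MemTrivializationAtlas e.1 := ⟨e.2⟩
  have : MemTrivializationAtlas e'.1 := ⟨e'.2⟩
  have h := (e.1.coordChangeL ℂ e'.1 x).map_smul v 1
  simp only [smul_eq_mul, mul_one] at h
  rw [h, mul_comm]
  rfl

theorem transition_ne_zero (e e' : trivializationAtlas ℂ L.Fiber) (x : X) :
    L.transition e e' x ≠ 0 := by
  have : MemTrivializationAtlas e.1 := ⟨e.2⟩
  have : MemTrivializationAtlas e'.1 := ⟨e'.2⟩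
  intro h
  exact one_ne_zero ((e.1.coordChangeL ℂ e'.1 x).map_eq_zero_iff.1 h)

theorem transition_self (e : trivializationAtlas ℂ L.Fiber) {x : X} (hx : x ∈ e.1.baseSet) :
    L.transition e e x = 1 := by
  have : MemTrivializationAtlas e.1 := ⟨e.2⟩
  change e.1.coordChangeL ℂ e.1 x 1 = 1
  rw [e.1.coordChangeL_apply' e.1 ⟨hx, hx⟩]
  change (e.1 (e.1.toOpenPartialHomeomorph.symm (x, 1))).2 = 1
  rw [e.1.apply_symm_apply' hx]

theorem transition_comp (e e' e'' : trivializationAtlas ℂ L.Fiber) {x : X}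
    (hx : x ∈ e.1.baseSet ∩ e'.1.baseSet ∩ e''.1.baseSet) :
    L.transition e' e'' x * L.transition e e' x = L.transition e e'' x := by
  have : MemTrivializationAtlas e.1 := ⟨e.2⟩
  have : MemTrivializationAtlas e'.1 := ⟨e'.2⟩
  have : MemTrivializationAtlas e''.1 := ⟨e''.2⟩
  rw [← L.transition_mul]
  change e'.1.coordChangeL ℂ e''.1 x (e.1.coordChangeL ℂ e'.1 x 1) = e.1.coordChangeL ℂ e''.1 x 1
  rw [e.1.coordChangeL_apply e'.1 ⟨hx.1.1, hx.1.2⟩, e'.1.coordChangeL_apply e''.1 ⟨hx.1.2, hx.2⟩,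
    e.1.coordChangeL_apply e''.1 ⟨hx.1.1, hx.2⟩,
    e'.1.symm_proj_apply ⟨x, e.1.symm x 1⟩ hx.1.2]

theorem contMDiffOn_transition (e e' : trivializationAtlas ℂ L.Fiber) :
    ContMDiffOn I 𝓘(ℂ) ω (L.transition e e') (e.1.baseSet ∩ e'.1.baseSet) := by
  have : MemTrivializationAtlas e.1 := ⟨e.2⟩
  have : MemTrivializationAtlas e'.1 := ⟨e'.2⟩
  exact (contMDiffOn_coordChangeL (IB := I) (n := ω) e.1 e'.1).clm_apply contMDiffOn_const

/-- Analyticity of integer powers of a nowhere vanishing function. -/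
theorem contMDiffOn_zpow {g : X → ℂ} {s : Set X} (hg : ContMDiffOn I 𝓘(ℂ) ω g s)
    (h0 : ∀ x, g x ≠ 0) (l : ℤ) : ContMDiffOn I 𝓘(ℂ) ω (fun x => g x ^ l) s := by
  intro x hx
  have h1 : ContDiffAt ℂ ω (fun z : ℂ => z ^ l) (g x) :=
    (analyticAt_id.fun_zpow (h0 x)).contDiffAt
  exact h1.contMDiffAt.comp_contMDiffWithinAt x (hg x hx)

/-- The cocycle `g_{ee'}^l` defining the `l`-th power of `L`. -/
def zpowCore (l : ℤ) : VectorBundleCore ℂ X ℂ (trivializationAtlas ℂ L.Fiber) where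
  baseSet e := e.1.baseSet
  isOpen_baseSet e := e.1.open_baseSet
  indexAt x := ⟨trivializationAt ℂ L.Fiber x, trivialization_mem_atlas ℂ L.Fiber x⟩
  mem_baseSet_at x := mem_baseSet_trivializationAt ℂ L.Fiber x
  coordChange e e' x := (L.transition e e' x ^ l) • ContinuousLinearMap.id ℂ ℂ
  coordChange_self e x hx v := by simp [L.transition_self e hx]
  continuousOn_coordChange e e' :=
    (contMDiffOn_zpow (L.contMDiffOn_transition e e')
      (L.transition_ne_zero e e') l).continuousOn.smul continuousOn_const
  coordChange_comp e e' e'' x hx v := by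
    simp [← L.transition_comp e e' e'' hx, mul_zpow, mul_assoc]

instance zpowCore_isContMDiff (l : ℤ) : (L.zpowCore l).IsContMDiff I ω where
  contMDiffOn_coordChange e e' :=
    (contMDiffOn_zpow (L.contMDiffOn_transition e e')
      (L.transition_ne_zero e e') l).smul contMDiffOn_const

/-- The power `L^{⊗ l}`, `l ∈ ℤ`, of a line bundle: if `L` has transition functions `g_{ee'}`, it
is the line bundle with transition functions `g_{ee'}^l`. -/
def zpow (l : ℤ) : HolomorphicLineBundle.{uE, uH, uX, 0} I X where
  Fiber := (L.zpowCore l).Fiber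

/-- The complement of the zero section, as an open subset of the total space of `L`. -/
def puncturedOpens : TopologicalSpace.Opens (TotalSpace ℂ L.Fiber) where
  carrier := {p | p.2 ≠ 0}
  is_open' := by
    rw [isOpen_iff_mem_nhds]
    intro p hp
    let e := trivializationAt ℂ L.Fiber p.1
    have hpe : p ∈ e.source := FiberBundle.mem_trivializationAt_proj_source
    have key : ∀ q ∈ e.source, ((e q).2 ≠ 0 ↔ q.2 ≠ 0) := by
      intro q hq
      have hq' : q.1 ∈ e.baseSet := e.mem_source.1 hq
      have : (e q).2 = e.linearEquivAt ℂ q.1 hq' q.2 := rfl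
      rw [this, ne_eq, ne_eq, LinearEquiv.map_eq_zero_iff]
    have h1 : ContinuousAt (fun q => (e q).2) p :=
      continuous_snd.continuousAt.comp (e.continuousAt hpe)
    filter_upwards [h1.eventually_ne ((key p hpe).2 hp), e.open_source.mem_nhds hpe] with q h2 h3
    exact (key q h3).1 h2

/-- `L^×`, the complement of the zero section of `L`; it is a complex manifold, being an open subset
of the total space. -/
abbrev Punctured : Type _ := L.puncturedOpens

/-- The right action of `ℂ^×` on `L^×` by scalar multiplication in the fibres. -/
instance : MulAction ℂˣᵐᵒᵖ L.Punctured where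
  smul c p := ⟨⟨p.1.1, (unop c : ℂˣ) • p.1.2⟩, (smul_ne_zero_iff_ne _).2 p.2⟩
  one_smul p := Subtype.ext (by
    change (⟨p.1.1, (1 : ℂˣ) • p.1.2⟩ : TotalSpace ℂ L.Fiber) = p.1
    rw [one_smul])
  mul_smul c d p := Subtype.ext (by
    change (⟨p.1.1, (unop (c * d) : ℂˣ) • p.1.2⟩ : TotalSpace ℂ L.Fiber) =
      ⟨p.1.1, (unop c : ℂˣ) • (unop d : ℂˣ) • p.1.2⟩
    rw [unop_mul, mul_comm, mul_smul])

/-- The projection `L^× → X`. -/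
def puncturedProj (p : L.Punctured) : X := p.1.1

end HolomorphicLineBundle

end LineBundles

/-! ## CY structures -/

section CY

variable {E : Type*} [NormedAddCommGroup E] [NormedSpace ℂ E]
  {HM : Type*} [TopologicalSpace HM] (J : ModelWithCorners ℂ E HM)
  {M : Type*} [TopologicalSpace M] [ChartedSpace HM M]
  {EH : Type*} [NormedAddCommGroup EH] [NormedSpace ℂ EH]
  {HH : Type*} [TopologicalSpace HH] (K : ModelWithCorners ℂ EH HH)
  {H : Type*} [Group H] [TopologicalSpace H] [ChartedSpace HH H]

variable (H) in
/-- An `H`-character: a holomorphic homomorphism `H → ℂ^×`. -/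
abbrev HolomorphicCharacter : Type _ := ContMDiffMonoidMorphism K 𝓘(ℂ) ω H ℂˣ

/-- The form `Γ_h Ω = (R_h)^* Ω`, where `R_h m = m h` is the right action of `h` on `M`; that is,
`(Γ_h Ω)_m` is the pullback of `Ω_{mh}` under the differential of `R_h` at `m`. -/
def translateForm [MulAction Hᵐᵒᵖ M] (h : H) (Ω : ∀ m : M, CanonicalFiber J m) :
    ∀ m : M, CanonicalFiber J m :=
  fun m => ContinuousAlternatingMap.compContinuousLinearMap (Ω (op h • m))
    (mfderiv J J (fun m' : M => op h • m') m)

/-- `(Ω, χ)` is a CY structure on `M` (with its right `H`-action): `Ω` is a nowhere vanishing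
holomorphic form of top degree on `M`, and `Γ_h Ω = χ(h) Ω` for all `h ∈ H`. -/
structure IsCYStructure [IsManifold J ω M] [MulAction Hᵐᵒᵖ M]
    (Ω : ∀ m : M, CanonicalFiber J m) (χ : HolomorphicCharacter K H) : Prop where
  holomorphic : ContMDiff J (J.prod 𝓘(ℂ, CanonicalModel E)) ω
    (fun m => (⟨m, Ω m⟩ : TotalSpace (CanonicalModel E) (fun m : M => CanonicalFiber J m)))
  nowhere_zero : ∀ m, Ω m ≠ 0
  equivariant : ∀ (h : H) (m : M), translateForm J h Ω m = ((χ h : ℂˣ) : ℂ) • Ω m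

variable (M H) in
/-- `M` admits a CY structure. -/
def AdmitsCYStructure [IsManifold J ω M] [MulAction Hᵐᵒᵖ M] : Prop :=
  ∃ (Ω : ∀ m : M, CanonicalFiber J m) (χ : HolomorphicCharacter K H), IsCYStructure J K Ω χ

end CY

/-! ## Principal bundles and associated line bundles -/

section Principal

variable {EX : Type uE} [NormedAddCommGroup EX] [NormedSpace ℂ EX]
  {HX : Type uH} [TopologicalSpace HX] (I : ModelWithCorners ℂ EX HX)
  {X : Type uX} [TopologicalSpace X] [ChartedSpace HX X]
  {EM : Type*} [NormedAddCommGroup EM] [NormedSpace ℂ EM]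
  {HM : Type*} [TopologicalSpace HM] (J : ModelWithCorners ℂ EM HM)
  {M : Type uM} [TopologicalSpace M] [ChartedSpace HM M]
  {EH : Type*} [NormedAddCommGroup EH] [NormedSpace ℂ EH]
  {HH : Type*} [TopologicalSpace HH] (K : ModelWithCorners ℂ EH HH)
  {H : Type*} [Group H] [TopologicalSpace H] [ChartedSpace HH H]
  [MulAction Hᵐᵒᵖ M]

/-- A local trivialization `p⁻¹(U) ≅ U × H` of `p : M → X` as a holomorphic principal `H`-bundle:
it is biholomorphic, and equivariant for the right actions of `H`. -/
structure IsPrincipalTrivialization {p : M → X} (e : Trivialization H p) : Prop where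
  equivariant : ∀ m ∈ e.source, ∀ h : H, (e (op h • m)).2 = (e m).2 * h
  holomorphic : ContMDiffOn J (I.prod K) ω e e.source
  holomorphic_symm : ContMDiffOn (I.prod K) J ω e.toOpenPartialHomeomorph.symm e.target

variable (H) in
/-- `p : M → X` is a holomorphic principal `H`-bundle: `H` acts holomorphically on the right on `M`,
preserving the fibres of `p`, and locally on `X` the bundle is biholomorphic, `H`-equivariantly, to
`U × H`. (So the action is free, and its orbits are the fibres of `p`.) -/
structure IsPrincipalBundle (p : M → X) : Prop where
  holomorphic_proj : ContMDiff J I ω p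
  holomorphic_action : ContMDiff (J.prod K) J ω (fun q : M × H => op q.2 • q.1)
  proj_smul : ∀ (h : H) (m : M), p (op h • m) = p m
  exists_trivialization : ∀ x : X, ∃ e : Trivialization H p,
    IsPrincipalTrivialization I J K e ∧ x ∈ e.baseSet

variable {I J K}

/-- On `M_x × ℂ`, the equivalence relation `(m, v) ∼ (m h⁻¹, χ(h) v)`, `h ∈ H`. -/
def assocSetoid (p : M → X) (χ : HolomorphicCharacter K H) (x : X) :
    Setoid ({m : M // p m = x} × ℂ) where
  r a b := ∃ h : H, (b.1 : M) = op h⁻¹ • (a.1 : M) ∧ b.2 = ((χ h : ℂˣ) : ℂ) * a.2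
  iseqv :=
    { refl := fun a => ⟨1, by simp, by simp⟩
      symm := by
        rintro a b ⟨h, h1, h2⟩
        refine ⟨h⁻¹, ?_, ?_⟩
        · rw [h1, smul_smul, ← op_mul]; simp
        · rw [h2, ← mul_assoc, ← Units.val_mul, ← map_mul]; simp
      trans := by
        rintro a b c ⟨h, h1, h2⟩ ⟨k, h3, h4⟩
        refine ⟨k * h, ?_, ?_⟩
        · rw [h3, h1, smul_smul, ← op_mul, mul_inv_rev]
        · rw [h4, h2, map_mul, Units.val_mul, mul_assoc] }

/-- The fibre over `x` of `M ×_H ℂ_χ`, i.e. the quotient of `M_x × ℂ` by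
`(m, v) ∼ (m h⁻¹, χ(h) v)`. -/
def AssocFiber {p : M → X} (_hp : IsPrincipalBundle I J K H p)
    (χ : HolomorphicCharacter K H) (x : X) : Type uM :=
  Quotient (assocSetoid p χ x)

namespace AssocFiber

variable {p : M → X} (hp : IsPrincipalBundle I J K H p) (χ : HolomorphicCharacter K H)

/-- The class `[m, v]` in the fibre of `M ×_H ℂ_χ` over `x = p(m)`. -/
def mk {x : X} (m : M) (hm : p m = x) (v : ℂ) : AssocFiber hp χ x :=
  Quotient.mk (assocSetoid p χ x) (⟨m, hm⟩, v)

/-- The coordinate on the fibre of `M ×_H ℂ_χ` defined by a local trivialization `e` of `M`: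
if `e(m) = (x, h)` then `[m, v] = [m h⁻¹, χ(h) v]` has coordinate `χ(h) v`. -/
def coord (e : Trivialization H p) {x : X} (q : AssocFiber hp χ x) : ℂ :=
  ((χ (e (Quotient.out (s := assocSetoid p χ x) q).1.1).2 : ℂˣ) : ℂ) *
    (Quotient.out (s := assocSetoid p χ x) q).2

variable {hp χ}

theorem coord_mk {e : Trivialization H p} (he : IsPrincipalTrivialization I J K e)
    {x : X} (hx : x ∈ e.baseSet) (m : M) (hm : p m = x) (v : ℂ) :
    coord hp χ e (mk hp χ m hm v) = ((χ (e m).2 : ℂˣ) : ℂ) * v := by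
  have key : ∀ a : {m : M // p m = x} × ℂ, (assocSetoid p χ x).r a (⟨m, hm⟩, v) →
      ((χ (e a.1.1).2 : ℂˣ) : ℂ) * a.2 = ((χ (e m).2 : ℂˣ) : ℂ) * v := by
    rintro ⟨⟨m', hm'⟩, v'⟩ ⟨h, h1, h2⟩
    have hs : m' ∈ e.source := by rw [e.mem_source, hm']; exact hx
    simp only at h1 h2
    rw [h1, h2, he.equivariant m' hs, ← mul_assoc, ← Units.val_mul, ← map_mul]
    simp
  exact key _ (Quotient.exact (s := assocSetoid p χ x)
    (Quotient.out_eq (s := assocSetoid p χ x) (mk hp χ m hm v)))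

variable (hp χ)

/-- The point of `M_x` which a local trivialization sends to `(x, 1)`. -/
theorem exists_unit_point (e : Trivialization H p) {x : X} (hx : x ∈ e.baseSet) :
    p (e.toOpenPartialHomeomorph.symm (x, 1)) = x :=
  e.proj_symm_apply' hx

variable {hp χ} in
theorem coord_mk_unit {e : Trivialization H p} (he : IsPrincipalTrivialization I J K e)
    {x : X} (hx : x ∈ e.baseSet) (v : ℂ) :
    coord hp χ e (mk hp χ _ (exists_unit_point e hx) v) = v := by
  rw [coord_mk he hx, e.apply_symm_apply' hx]
  simp

variable {hp χ} in
theorem mk_unit_coord {e : Trivialization H p} (he : IsPrincipalTrivialization I J K e)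
    {x : X} (hx : x ∈ e.baseSet) (q : AssocFiber hp χ x) :
    mk hp χ _ (exists_unit_point e hx) (coord hp χ e q) = q := by
  obtain ⟨⟨⟨m, hm⟩, v⟩, rfl⟩ := Quotient.exists_rep q
  change mk hp χ _ _ (coord hp χ e (mk hp χ m hm v)) = mk hp χ m hm v
  rw [coord_mk he hx]
  have hms : m ∈ e.source := by rw [e.mem_source, hm]; exact hx
  refine Eq.symm (Quotient.sound (s := assocSetoid p χ x) ⟨(e m).2, ?_, rfl⟩)
  have hms' : op (e m).2⁻¹ • m ∈ e.source := by rw [e.mem_source, hp.proj_smul, hm]; exact hx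
  apply e.injOn (e.map_target (e.mem_target.2 hx)) hms'
  change e (e.toOpenPartialHomeomorph.symm (x, 1)) = e (op (e m).2⁻¹ • m)
  rw [e.apply_symm_apply' hx]
  refine Prod.ext ?_ ?_
  · rw [e.coe_fst hms', hp.proj_smul, hm]
  · rw [he.equivariant m hms]; simp

/-- A chosen local trivialization of `M` around `x`. -/
def trivAt (x : X) : Trivialization H p := (hp.exists_trivialization x).choose

theorem trivAt_principal (x : X) : IsPrincipalTrivialization I J K (trivAt hp x) :=
  (hp.exists_trivialization x).choose_spec.1

theorem mem_trivAt (x : X) : x ∈ (trivAt hp x).baseSet :=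
  (hp.exists_trivialization x).choose_spec.2

/-- The coordinate defined by the chosen local trivialization, as a bijection with `ℂ`. -/
def coordEquiv (x : X) : AssocFiber hp χ x ≃ ℂ where
  toFun q := coord hp χ (trivAt hp x) q
  invFun v := mk hp χ _ (exists_unit_point (trivAt hp x) (mem_trivAt hp x)) v
  left_inv q := mk_unit_coord (trivAt_principal hp x) (mem_trivAt hp x) q
  right_inv v := coord_mk_unit (trivAt_principal hp x) (mem_trivAt hp x) v

/-- The vector space structure on the fibres; by `mk_add` and `mk_smul` below it is the one for
which every `v ↦ [m, v]` is linear. -/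
instance (x : X) : AddCommGroup (AssocFiber hp χ x) := (coordEquiv hp χ x).addCommGroup

instance (x : X) : Module ℂ (AssocFiber hp χ x) := (coordEquiv hp χ x).module ℂ

instance (x : X) : TopologicalSpace (AssocFiber hp χ x) :=
  TopologicalSpace.induced (coordEquiv hp χ x) inferInstance

theorem mk_add {x : X} (m : M) (hm : p m = x) (v w : ℂ) :
    mk hp χ m hm (v + w) = mk hp χ m hm v + mk hp χ m hm w := by
  apply (coordEquiv hp χ x).injective
  rw [Equiv.add_def, Equiv.apply_symm_apply]
  simp only [coordEquiv, Equiv.coe_fn_mk, coord_mk (trivAt_principal hp x) (mem_trivAt hp x)]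
  ring

theorem mk_smul {x : X} (m : M) (hm : p m = x) (c v : ℂ) :
    mk hp χ m hm (c * v) = c • mk hp χ m hm v := by
  apply (coordEquiv hp χ x).injective
  rw [Equiv.smul_def, Equiv.apply_symm_apply]
  simp only [coordEquiv, Equiv.coe_fn_mk, coord_mk (trivAt_principal hp x) (mem_trivAt hp x),
    smul_eq_mul]
  ring

/-- The local trivialization of `M ×_H ℂ_χ` induced by a local trivialization of `M`. -/
def pretrivialization (e : Trivialization H p) (he : IsPrincipalTrivialization I J K e) :
    Pretrivialization ℂ (π ℂ (AssocFiber hp χ)) where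
  toFun q := (q.1, coord hp χ e q.2)
  invFun a := ⟨a.1, open Classical in
    if hx : a.1 ∈ e.baseSet then mk hp χ _ (exists_unit_point e hx) a.2 else 0⟩
  source := π ℂ (AssocFiber hp χ) ⁻¹' e.baseSet
  target := e.baseSet ×ˢ univ
  map_source' q hq := ⟨hq, mem_univ _⟩
  map_target' a ha := ha.1
  left_inv' := by
    rintro ⟨x, q⟩ (hx : x ∈ e.baseSet)
    simp only [dif_pos hx, mk_unit_coord he hx]
  right_inv' := by
    rintro ⟨x, v⟩ ⟨hx : x ∈ e.baseSet, -⟩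
    simp only [dif_pos hx, coord_mk_unit he hx]
  open_target := e.open_baseSet.prod isOpen_univ
  baseSet := e.baseSet
  open_baseSet := e.open_baseSet
  source_eq := rfl
  target_eq := rfl
  proj_toFun _ _ := rfl

theorem pretrivialization_symm (e : Trivialization H p) (he : IsPrincipalTrivialization I J K e)
    {x : X} (hx : x ∈ e.baseSet) (v : ℂ) :
    (pretrivialization hp χ e he).symm x v = mk hp χ _ (exists_unit_point e hx) v := by
  have h1 : coord hp χ e ((pretrivialization hp χ e he).symm x v) = v :=
    congrArg Prod.snd ((pretrivialization hp χ e he).apply_mk_symm hx v)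
  rw [← mk_unit_coord he hx ((pretrivialization hp χ e he).symm x v), h1]

/-- The transition function of `M ×_H ℂ_χ`: if `h(x) ∈ H` is the transition function of `M`, it is
`χ(h(x))`. -/
def cocycle (e e' : Trivialization H p) (x : X) : ℂ :=
  ((χ (e' (e.toOpenPartialHomeomorph.symm (x, 1))).2 : ℂˣ) : ℂ)

theorem contMDiffOn_cocycle {e e' : Trivialization H p}
    (he : IsPrincipalTrivialization I J K e) (he' : IsPrincipalTrivialization I J K e') :
    ContMDiffOn I 𝓘(ℂ) ω (cocycle χ e e') (e.baseSet ∩ e'.baseSet) := by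
  have h1 : ContMDiffOn I (I.prod K) ω (fun x : X => (x, (1 : H))) (e.baseSet ∩ e'.baseSet) :=
    contMDiffOn_id.prodMk contMDiffOn_const
  have h2 : ContMDiffOn I J ω (fun x : X => e.toOpenPartialHomeomorph.symm (x, (1 : H)))
      (e.baseSet ∩ e'.baseSet) :=
    he.holomorphic_symm.comp h1 (fun x hx => e.mem_target.2 hx.1)
  have h3 : ContMDiffOn I (I.prod K) ω
      (fun x : X => e' (e.toOpenPartialHomeomorph.symm (x, (1 : H)))) (e.baseSet ∩ e'.baseSet) :=
    he'.holomorphic.comp h2 (fun x hx => by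
      change _ ∈ e'.source
      rw [e'.mem_source, exists_unit_point e hx.1]; exact hx.2)
  have h4 : ContMDiffOn I K ω
      (fun x : X => (e' (e.toOpenPartialHomeomorph.symm (x, (1 : H)))).2)
      (e.baseSet ∩ e'.baseSet) := contMDiff_snd.comp_contMDiffOn h3
  have h5 : ContMDiff K 𝓘(ℂ) ω (fun h : H => ((χ h : ℂˣ) : ℂ)) :=
    Units.contMDiff_val.comp χ.contMDiff_toFun
  exact h5.comp_contMDiffOn h4

theorem coordChange_eq {e e' : Trivialization H p}
    (he : IsPrincipalTrivialization I J K e) (he' : IsPrincipalTrivialization I J K e')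
    {x : X} (hx : x ∈ e.baseSet ∩ e'.baseSet) (v : ℂ) :
    (cocycle χ e e' x • ContinuousLinearMap.id ℂ ℂ) v =
      (pretrivialization hp χ e' he' ⟨x, (pretrivialization hp χ e he).symm x v⟩).2 := by
  rw [pretrivialization_symm hp χ e he hx.1]
  change _ = coord hp χ e' (mk hp χ _ _ v)
  rw [coord_mk he' hx.2]
  rfl

/-- The local trivializations of `M ×_H ℂ_χ` induced by those of `M`. -/
def prebundle : VectorPrebundle ℂ ℂ (AssocFiber hp χ) where
  pretrivializationAtlas := {t | ∃ (e : Trivialization H p)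
    (he : IsPrincipalTrivialization I J K e), t = pretrivialization hp χ e he}
  pretrivialization_linear' := by
    rintro _ ⟨e, he, rfl⟩
    refine ⟨fun x (hx : x ∈ e.baseSet) => ⟨fun a b => ?_, fun c a => ?_⟩⟩
    · change coord hp χ e (a + b) = coord hp χ e a + coord hp χ e b
      rw [← mk_unit_coord he hx a, ← mk_unit_coord he hx b, ← mk_add]
      simp only [coord_mk_unit he hx]
    · change coord hp χ e (c • a) = c • coord hp χ e a
      rw [← mk_unit_coord he hx a, ← mk_smul]
      simp only [coord_mk_unit he hx, smul_eq_mul]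
  pretrivializationAt x := pretrivialization hp χ (trivAt hp x) (trivAt_principal hp x)
  mem_base_pretrivializationAt x := mem_trivAt hp x
  pretrivialization_mem_atlas x := ⟨_, _, rfl⟩
  exists_coordChange := by
    rintro _ ⟨e, he, rfl⟩ _ ⟨e', he', rfl⟩
    exact ⟨fun x => cocycle χ e e' x • ContinuousLinearMap.id ℂ ℂ,
      (contMDiffOn_cocycle χ he he').continuousOn.smul continuousOn_const,
      fun x hx v => coordChange_eq hp χ he he' hx v⟩
  totalSpaceMk_isInducing x := by
    have : IsInducing (coordEquiv hp χ x) := ⟨rfl⟩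
    exact isInducing_const_prod.2 this

instance prebundle_isContMDiff : (prebundle hp χ).IsContMDiff I ω where
  exists_contMDiffCoordChange := by
    rintro _ ⟨e, he, rfl⟩ _ ⟨e', he', rfl⟩
    exact ⟨fun x => cocycle χ e e' x • ContinuousLinearMap.id ℂ ℂ,
      (contMDiffOn_cocycle χ he he').smul contMDiffOn_const,
      fun x hx v => coordChange_eq hp χ he he' hx v⟩

end AssocFiber

/-- The associated holomorphic line bundle `L_χ = M ×_H ℂ_χ` over `X`: its total space is the
quotient of `M × ℂ` by `(m, v) ∼ (m h⁻¹, χ(h) v)`, with the local trivializations induced by those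
of `M`. -/
def associatedLineBundle {p : M → X} (hp : IsPrincipalBundle I J K H p)
    (χ : HolomorphicCharacter K H) : HolomorphicLineBundle.{uE, uH, uX, uM} I X :=
  letI := (AssocFiber.prebundle hp χ).totalSpaceTopology
  letI := (AssocFiber.prebundle hp χ).toFiberBundle
  letI := (AssocFiber.prebundle hp χ).toVectorBundle
  { Fiber := AssocFiber hp χ
    holomorphic := (AssocFiber.prebundle hp χ).contMDiffVectorBundle I }

end Principal

/-- `H`-equivariant isomorphism over `X` of the total spaces `p : M → X`, `p' : M' → X` of two
principal `H`-bundles: a biholomorphic map commuting with the projections and with the right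
actions of `H`. -/
def EquivariantlyIsomorphic {X : Type*}
    {EM : Type*} [NormedAddCommGroup EM] [NormedSpace ℂ EM]
    {HM : Type*} [TopologicalSpace HM] (J : ModelWithCorners ℂ EM HM)
    {M : Type*} [TopologicalSpace M] [ChartedSpace HM M]
    {EM' : Type*} [NormedAddCommGroup EM'] [NormedSpace ℂ EM']
    {HM' : Type*} [TopologicalSpace HM'] (J' : ModelWithCorners ℂ EM' HM')
    {M' : Type*} [TopologicalSpace M'] [ChartedSpace HM' M']
    (H : Type*) [Group H] [MulAction Hᵐᵒᵖ M] [MulAction Hᵐᵒᵖ M']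
    (p : M → X) (p' : M' → X) : Prop :=
  ∃ Φ : M ≃ₘ^ω⟮J, J'⟯ M', (∀ m, p' (Φ m) = p m) ∧ ∀ (h : H) (m : M), Φ (op h • m) = op h • Φ m

end CYBundle

end

/-!
Let `p : M → X` be a principal `H`-bundle. The differential of the action at `m` and that of `p` fit
into a short exact sequence `0 → 𝔥 → T_m M → T_{p(m)} X → 0`. Contracting a top form `Ω_m` with the
images of a fixed basis of `𝔥` therefore identifies top forms on `T_m M` with top forms `β_m` on
`T_{p(m)} X` (`exists_contraction`, `exists_form_of_contraction`). Holomorphy is preserved in both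
directions, because both families have the same values on suitable local holomorphic frames
(`contMDiff_contraction_iff`). The fundamental vector fields transform under `R_h` by the adjoint
representation, so `R_h^* Ω = χ(h) Ω` holds for all `h` if and only if
`β_{mh} = χ(h) det(Ad_h) β_m` (`translate_apply_sumElim`); as `det Ad` is itself a holomorphic
character, CY structures on `M` are the same as nowhere vanishing holomorphic sections `β` of
`p^* K_X` which transform under some character `ψ` of `H`.

Such a section is the same as an isomorphism `M ×_H ℂ_ψ ≅ K_X`: the section gives
`[m, v] ↦ v β_m` (`IsEquivariantSection.holomorphicallyIsomorphic`), and an isomorphism `Φ` from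
`K_X` to the associated bundle gives `β_m = Φ⁻¹ [m, 1]` (`exists_isEquivariantSection`). This is
the criterion `admitsCYStructure_iff` for arbitrary `H`.

For `H = ℂ^×` every holomorphic character is `c ↦ c ^ l` for an integer `l`, since its composition
with `exp` is `z ↦ exp (a z)` with `exp (2πi a) = 1` (`exists_eq_zpowCharacter`). If `M` maps
equivariantly to `L^×` by `q`, then `m ↦ q(m)^{⊗ l}` is an equivariant section of the pullback of
`L^{⊗ l}`, so that `L^{⊗ l}` is the bundle associated to `M` by `c ↦ c ^ l`
(`zpow_holomorphicallyIsomorphic`), and the general criterion becomes that `K_X` is a power of `L`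
(`admitsCYStructure_iff_zpow`). For `M = L^×` the map `q` is the identity. A general `M` maps to
`L^×` by `m ↦ [m, 1]`, where `L` is the line bundle associated to `M` by the identity character, and
a holomorphic equivariant map between principal bundles over the identity of the base is an
isomorphism (`equivariantlyIsomorphic_of_map`).
-/

noncomputable section

namespace CYBundle

/-! ### Top forms and short exact sequences of vector spaces -/

section LinearAlgebra

variable {𝕜 : Type*} [Field 𝕜] {T V : Type*} [AddCommGroup T] [Module 𝕜 T]
  [AddCommGroup V] [Module 𝕜 V] {W : Type*} [AddCommGroup W] [Module 𝕜 W] {ι κ : Type*}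

theorem linearIndependent_sumElim_of_lift {v : ι → V} (hv : LinearIndependent 𝕜 v)
    (p : T →ₗ[𝕜] V) {a : κ → T} (ha : LinearIndependent 𝕜 a) (hpa : ∀ j, p (a j) = 0)
    {w : ι → T} (hw : ∀ i, p (w i) = v i) : LinearIndependent 𝕜 (Sum.elim w a) := by
  have hwv : p ∘ w = v := funext hw
  have hw' : LinearIndependent 𝕜 (p ∘ w) := hwv ▸ hv
  refine LinearIndependent.sum_type hw'.of_comp ha ?_
  refine Disjoint.mono_right (c := LinearMap.ker p) ?_ ?_
  · rw [Submodule.span_le]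
    rintro _ ⟨j, rfl⟩
    exact hpa j
  · exact Submodule.range_ker_disjoint hw'

variable [Fintype ι] [Fintype κ] [DecidableEq ι] [DecidableEq κ]

/-- A frame `b` of `T` adapted to an exact sequence `0 → W → T → V → 0` splits determinants: those
of `(u, A ∘ y)` are block triangular. -/
theorem det_sumElim_of_lift (b : Module.Basis (ι ⊕ κ) 𝕜 T) (v : Module.Basis ι 𝕜 V)
    (ξ : Module.Basis κ 𝕜 W) (p : T →ₗ[𝕜] V) (A : W →ₗ[𝕜] T) (hpA : ∀ z, p (A z) = 0)
    (hpl : ∀ i, p (b (Sum.inl i)) = v i) (hpr : ∀ j, b (Sum.inr j) = A (ξ j))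
    (u : ι → T) (y : κ → W) :
    b.det (Sum.elim u (A ∘ y)) = v.det (p ∘ u) * ξ.det y := by
  have hrepr : ∀ t i, b.repr t (Sum.inl i) = v.repr (p t) i := by
    intro t i
    have ht : p t = ∑ k, b.repr t (Sum.inl k) • v k := by
      conv_lhs => rw [← b.sum_repr t, map_sum, Fintype.sum_sum_type]
      simp only [map_smul, hpl, hpr, hpA, smul_zero, Finset.sum_const_zero, add_zero]
    rw [ht, v.repr_sum_self]
  have hrepr' : ∀ z j, b.repr (A z) (Sum.inr j) = ξ.repr z j := by
    intro z j
    have hz : A z = ∑ k, (Sum.elim 0 (ξ.repr z) : ι ⊕ κ → 𝕜) k • b k := by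
      conv_lhs => rw [← ξ.sum_repr z, map_sum]
      rw [Fintype.sum_sum_type]
      simp only [Sum.elim_inl, Pi.zero_apply, zero_smul, Finset.sum_const_zero, zero_add,
        Sum.elim_inr, hpr, map_smul]
    rw [hz, b.repr_sum_self]
    rfl
  rw [Module.Basis.det_apply, Module.Basis.det_apply, Module.Basis.det_apply]
  have : b.toMatrix (Sum.elim u (A ∘ y)) =
      Matrix.fromBlocks (v.toMatrix (p ∘ u)) 0
        (Matrix.of fun j i => b.repr (u i) (Sum.inr j)) (ξ.toMatrix y) := by
    ext (i | i) (j | j)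
    · simp [Module.Basis.toMatrix_apply, hrepr]
    · simp [Module.Basis.toMatrix_apply, hrepr, hpA]
    · simp [Module.Basis.toMatrix_apply]
    · simp [Module.Basis.toMatrix_apply, hrepr']
  rw [this, Matrix.det_fromBlocks_zero₁₂]

/-- For an exact sequence `0 → W → T → V → 0` with maps `A` and `p`, and lifts `w` to `T` of a basis
`v` of `V`, the value of a top form on `T` at `(u, A ∘ y)` factors through `p ∘ u` and `y`. -/
theorem map_sumElim_eq_mul_det (v : Module.Basis ι 𝕜 V) (ξ : Module.Basis κ 𝕜 W) (p : T →ₗ[𝕜] V)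
    (A : W →ₗ[𝕜] T) (hA : Function.Injective A) (hpA : ∀ z, p (A z) = 0)
    {w : ι → T} (hw : ∀ i, p (w i) = v i)
    (hcard : Fintype.card (ι ⊕ κ) = Module.finrank 𝕜 T)
    (f : T [⋀^ι ⊕ κ]→ₗ[𝕜] 𝕜) (u : ι → T) (y : κ → W) :
    f (Sum.elim u (A ∘ y)) = f (Sum.elim w (A ∘ ξ)) * (v.det (p ∘ u) * ξ.det y) := by
  have hξ : LinearIndependent 𝕜 (A ∘ ξ) :=
    ξ.linearIndependent.map' A (LinearMap.ker_eq_bot.2 hA)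
  have hli := linearIndependent_sumElim_of_lift v.linearIndependent p hξ (fun j => hpA _) hw
  by_cases hne : Nonempty (ι ⊕ κ)
  · let b : Module.Basis (ι ⊕ κ) 𝕜 T := basisOfLinearIndependentOfCardEqFinrank hli hcard
    have hb : ⇑b = Sum.elim w (A ∘ ξ) := coe_basisOfLinearIndependentOfCardEqFinrank hli hcard
    have := det_sumElim_of_lift b v ξ p A hpA (fun i => by rw [hb]; exact hw i)
      (fun j => by rw [hb]; rfl) u y
    rw [← this, ← hb]
    conv_lhs => rw [f.eq_smul_basis_det b]
    rfl
  · rw [not_nonempty_iff, isEmpty_sum] at hne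
    obtain ⟨h1, h2⟩ := hne
    rw [Module.Basis.det_apply, Matrix.det_isEmpty, Module.Basis.det_apply, Matrix.det_isEmpty,
      mul_one, mul_one]
    exact congrArg f (Subsingleton.elim _ _)

end LinearAlgebra

section TopForms
variable {V : Type*} [AddCommGroup V] [Module ℂ V] {ι : Type*} [Fintype ι] [DecidableEq ι]

theorem contDiff_basis_det {E : Type*} [NormedAddCommGroup E] [NormedSpace ℂ E]
    [FiniteDimensional ℂ E] (e : Module.Basis ι ℂ E) :
    ContDiff ℂ ω (fun u : ι → E => e.det u) := by
  simp only [Module.Basis.det_apply, Matrix.det_apply]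
  refine ContDiff.sum fun σ _ => ContDiff.const_smul _ (contDiff_prod fun i _ => ?_)
  change ContDiff ℂ ω (fun u : ι → E => e.coord (σ i) (u i))
  exact ((LinearMap.toContinuousLinearMap (e.coord (σ i))).contDiff).comp (contDiff_apply _ _ i)

/-- The determinant form of a basis of a finite-dimensional space as a continuous alternating
map. -/
def detForm [TopologicalSpace V] [IsTopologicalAddGroup V] [ContinuousSMul ℂ V] [T2Space V]
    [FiniteDimensional ℂ V] (e : Module.Basis ι ℂ V) : V [⋀^ι]→L[ℂ] ℂ :=
  { e.det with
    cont := by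
      change Continuous fun u : ι → V => e.det u
      simp only [Module.Basis.det_apply, Matrix.det_apply]
      refine continuous_finsetSum _ fun σ _ => Continuous.const_smul
        (continuous_finsetProd _ fun i _ => ?_) _
      change Continuous (fun u : ι → V => e.coord (σ i) (u i))
      exact (LinearMap.continuous_of_finiteDimensional _).comp (continuous_apply i) }

theorem canonicalModel_eq_smul {V : Type*} [NormedAddCommGroup V] [NormedSpace ℂ V]
    [FiniteDimensional ℂ V] (f : CanonicalModel V) :
    f = f (Module.finBasis ℂ V) • detForm (Module.finBasis ℂ V) := by
  ext u
  exact congrArg (fun g => g u) (f.toAlternatingMap.eq_smul_basis_det (Module.finBasis ℂ V))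

end TopForms

/-! ### Holomorphic families of top forms -/

section FormsAlongMaps

variable {E : Type*} [NormedAddCommGroup E] [NormedSpace ℂ E]
  {HX : Type*} [TopologicalSpace HX] {I : ModelWithCorners ℂ E HX}
  {X : Type*} [TopologicalSpace X] [ChartedSpace HX X] [IsManifold I ω X]
  {EY : Type*} [NormedAddCommGroup EY] [NormedSpace ℂ EY]
  {HY : Type*} [TopologicalSpace HY] {IY : ModelWithCorners ℂ EY HY}
  {Y : Type*} [TopologicalSpace Y] [ChartedSpace HY Y]

theorem trivializationAt_canonical_apply (x₀ x : X) (β : CanonicalFiber I x)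
    (u : Fin (Module.finrank ℂ E) → E) :
    (trivializationAt (CanonicalModel E) (fun x : X => CanonicalFiber I x) x₀ ⟨x, β⟩).2 u =
      β (fun i => (trivializationAt E (TangentSpace I) x₀).symmL ℂ x (u i)) := by
  rw [FiberBundle.trivializationAt_continuousAlternatingMap_apply]
  simp [ContinuousAlternatingMap.inCoordinates, Function.comp_def]

variable [FiniteDimensional ℂ E]

/-- A top form is its coordinate times the determinant of the coordinates of its arguments. -/
theorem canonical_apply_eq_mul_det (x₀ : X) {x : X}
    (hx : x ∈ (trivializationAt E (TangentSpace I : X → Type _) x₀).baseSet)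
    (β : CanonicalFiber I x) (V : Fin (Module.finrank ℂ E) → TangentSpace I x) :
    β V = (trivializationAt (CanonicalModel E) (fun x : X => CanonicalFiber I x) x₀ ⟨x, β⟩).2
        (Module.finBasis ℂ E) *
      (Module.finBasis ℂ E).det
        (fun i => (trivializationAt E (TangentSpace I : X → Type _) x₀ ⟨x, V i⟩).2) := by
  have h1 := congrArg (fun g : CanonicalModel E => g
    (fun i => (trivializationAt E (TangentSpace I : X → Type _) x₀ ⟨x, V i⟩).2))
    (canonicalModel_eq_smul
      (trivializationAt (CanonicalModel E) (fun x : X => CanonicalFiber I x) x₀ ⟨x, β⟩).2)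
  beta_reduce at h1
  rw [trivializationAt_canonical_apply] at h1
  have h2 : (fun i => (trivializationAt E (TangentSpace I : X → Type _) x₀).symmL ℂ x
      (trivializationAt E (TangentSpace I : X → Type _) x₀ ⟨x, V i⟩).2) = V := by
    funext i
    have := (trivializationAt E (TangentSpace I : X → Type _) x₀).symmL_continuousLinearMapAt
      (R := ℂ) hx (V i)
    rwa [Trivialization.continuousLinearMapAt_apply,
      Trivialization.coe_linearMapAt_of_mem _ hx] at this
  rw [h2] at h1
  exact h1

/-- Evaluating a holomorphic family of top forms on a frame of holomorphic families of tangent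
vectors gives a holomorphic function. -/
theorem contMDiffAt_form_apply {f : Y → X} {β : ∀ y, CanonicalFiber I (f y)}
    {V : ∀ y, Fin (Module.finrank ℂ E) → TangentSpace I (f y)} {y₀ : Y}
    (hβ : ContMDiffAt IY (I.prod 𝓘(ℂ, CanonicalModel E)) ω
      (fun y => (⟨f y, β y⟩ : TotalSpace (CanonicalModel E) (fun x : X => CanonicalFiber I x))) y₀)
    (hV : ∀ i, ContMDiffAt IY (I.prod 𝓘(ℂ, E)) ω
      (fun y => (⟨f y, V y i⟩ : TotalSpace E (TangentSpace I : X → Type _))) y₀) :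
    ContMDiffAt IY 𝓘(ℂ) ω (fun y => β y (V y)) y₀ := by
  rw [contMDiffAt_totalSpace] at hβ
  simp only [contMDiffAt_totalSpace] at hV
  have hdet : ContMDiffAt IY 𝓘(ℂ) ω (fun y => (Module.finBasis ℂ E).det
      (fun i => (trivializationAt E (TangentSpace I : X → Type _) (f y₀) ⟨f y, V y i⟩).2)) y₀ :=
    (contDiff_basis_det (Module.finBasis ℂ E)).contMDiff.contMDiffAt.comp y₀
      (contMDiffAt_pi_space.2 fun i => (hV i).2)
  have hc : ContMDiffAt IY 𝓘(ℂ) ω (fun y => (trivializationAt (CanonicalModel E)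
      (fun x : X => CanonicalFiber I x) (f y₀) ⟨f y, β y⟩).2 (Module.finBasis ℂ E)) y₀ :=
    (ContinuousAlternatingMap.apply ℂ E ℂ (Module.finBasis ℂ E)).contMDiff.contMDiffAt.comp y₀ hβ.2
  refine (hc.mul hdet).congr_of_eventuallyEq ?_
  filter_upwards [hβ.1.continuousAt ((trivializationAt E (TangentSpace I : X → Type _)
    (f y₀)).open_baseSet.mem_nhds (FiberBundle.mem_baseSet_trivializationAt' (f y₀)))] with y hy
  exact canonical_apply_eq_mul_det (f y₀) hy _ _

/-- A family of top forms is holomorphic as soon as its values on one frame of holomorphic families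
of tangent vectors are. -/
theorem contMDiffAt_form_of_apply {f : Y → X} {β : ∀ y, CanonicalFiber I (f y)}
    {V : ∀ y, Fin (Module.finrank ℂ E) → TangentSpace I (f y)} {y₀ : Y}
    (hf : ContMDiffAt IY I ω f y₀)
    (hV : ∀ i, ContMDiffAt IY (I.prod 𝓘(ℂ, E)) ω
      (fun y => (⟨f y, V y i⟩ : TotalSpace E (TangentSpace I : X → Type _))) y₀)
    (hV₀ : LinearIndependent ℂ (V y₀))
    (hβ : ContMDiffAt IY 𝓘(ℂ) ω (fun y => β y (V y)) y₀) :
    ContMDiffAt IY (I.prod 𝓘(ℂ, CanonicalModel E)) ω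
      (fun y => (⟨f y, β y⟩ : TotalSpace (CanonicalModel E) (fun x : X => CanonicalFiber I x)))
      y₀ := by
  rw [contMDiffAt_totalSpace]
  simp only [contMDiffAt_totalSpace] at hV
  refine ⟨hf, ?_⟩
  set e := trivializationAt E (TangentSpace I : X → Type _) (f y₀)
  have hdet : ContMDiffAt IY 𝓘(ℂ) ω (fun y => (Module.finBasis ℂ E).det
      (fun i => (e ⟨f y, V y i⟩).2)) y₀ :=
    (contDiff_basis_det (Module.finBasis ℂ E)).contMDiff.contMDiffAt.comp y₀
      (contMDiffAt_pi_space.2 fun i => (hV i).2)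
  have hne : (Module.finBasis ℂ E).det (fun i => (e ⟨f y₀, V y₀ i⟩).2) ≠ 0 := by
    have hmem : f y₀ ∈ e.baseSet := FiberBundle.mem_baseSet_trivializationAt' (f y₀)
    have hli : LinearIndependent ℂ (fun i => (e ⟨f y₀, V y₀ i⟩).2) :=
      hV₀.map' (e.linearEquivAt ℂ (f y₀) hmem).toLinearMap (LinearEquiv.ker _)
    refine IsUnit.ne_zero ((Module.Basis.is_basis_iff_det _).1 ⟨hli, ?_⟩)
    exact hli.span_eq_top_of_card_eq_finrank' (by simp)
  have hev : ∀ᶠ y in 𝓝 y₀, f y ∈ e.baseSet := hf.continuousAt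
    (e.open_baseSet.mem_nhds (FiberBundle.mem_baseSet_trivializationAt' (f y₀)))
  have hc : ContMDiffAt IY 𝓘(ℂ) ω (fun y => (trivializationAt (CanonicalModel E)
      (fun x : X => CanonicalFiber I x) (f y₀) ⟨f y, β y⟩).2 (Module.finBasis ℂ E)) y₀ := by
    refine (hβ.div₀ hdet hne).congr_of_eventuallyEq ?_
    filter_upwards [hev, hdet.continuousAt.eventually_ne hne] with y hy hy'
    rw [Pi.div_apply, canonical_apply_eq_mul_det (f y₀) hy, mul_div_cancel_right₀ _ hy']
  refine (hc.smul contMDiffAt_const).congr_of_eventuallyEq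
    (f₁ := fun y => (trivializationAt (CanonicalModel E)
      (fun x : X => CanonicalFiber I x) (f y₀) ⟨f y, β y⟩).2)
    (f := fun y => (trivializationAt (CanonicalModel E)
      (fun x : X => CanonicalFiber I x) (f y₀) ⟨f y, β y⟩).2 (Module.finBasis ℂ E) •
        detForm (Module.finBasis ℂ E)) ?_
  filter_upwards with y
  exact canonicalModel_eq_smul _

end FormsAlongMaps

section PartialDerivative

variable {E : Type*} [NormedAddCommGroup E] [NormedSpace ℂ E]
  {HX : Type*} [TopologicalSpace HX] {I : ModelWithCorners ℂ E HX}
  {X : Type*} [TopologicalSpace X] [ChartedSpace HX X] [IsManifold I ω X]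
  {EY : Type*} [NormedAddCommGroup EY] [NormedSpace ℂ EY]
  {HY : Type*} [TopologicalSpace HY] {IY : ModelWithCorners ℂ EY HY}
  {Y : Type*} [TopologicalSpace Y] [ChartedSpace HY Y] [IsManifold IY ω Y]
  {EZ : Type*} [NormedAddCommGroup EZ] [NormedSpace ℂ EZ]
  {HZ : Type*} [TopologicalSpace HZ] {IZ : ModelWithCorners ℂ EZ HZ}
  {Z : Type*} [TopologicalSpace Z] [ChartedSpace HZ Z] [IsManifold IZ ω Z]

/-- The partial derivative of a holomorphic map `F : Y × X → Z` in the direction of a holomorphic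
family of tangent vectors of `X` is a holomorphic family of tangent vectors of `Z`. -/
theorem contMDiffAt_mfderiv_apply (F : Y → X → Z) (g : Y → X) (V : ∀ y, TangentSpace I (g y))
    {y₀ : Y} (hF : ContMDiffAt (IY.prod I) IZ ω (Function.uncurry F) (y₀, g y₀))
    (hV : ContMDiffAt IY (I.prod 𝓘(ℂ, E)) ω
      (fun y => (⟨g y, V y⟩ : TotalSpace E (TangentSpace I : X → Type _))) y₀) :
    ContMDiffAt IY (IZ.prod 𝓘(ℂ, EZ)) ω
      (fun y => (⟨F y (g y), mfderiv I IZ (F y) (g y) (V y)⟩ :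
        TotalSpace EZ (TangentSpace IZ : Z → Type _))) y₀ := by
  have hg : ContMDiffAt IY I ω g y₀ := (contMDiffAt_totalSpace.1 hV).1
  have hFg : ContMDiffAt IY IZ ω (fun y => F y (g y)) y₀ :=
    hF.comp y₀ (contMDiffAt_id.prodMk hg)
  exact ContMDiffAt.clm_apply_of_inCoordinates
    (b₁ := g) (b₂ := fun y => F y (g y)) (v := V)
    (ϕ := fun y => mfderiv I IZ (F y) (g y)) (hF.mfderiv F g hg le_rfl) hV hFg

end PartialDerivative

/-! ### Isomorphisms of line bundles -/

section LineBundleMaps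

variable {E : Type*} [NormedAddCommGroup E] [NormedSpace ℂ E]
  {HX : Type*} [TopologicalSpace HX] {I : ModelWithCorners ℂ E HX}
  {X : Type*} [TopologicalSpace X] [ChartedSpace HX X]
  {F₁ : Type*} [NormedAddCommGroup F₁] [NormedSpace ℂ F₁] {V₁ : X → Type*}
  [∀ x, TopologicalSpace (V₁ x)] [∀ x, AddCommGroup (V₁ x)] [∀ x, Module ℂ (V₁ x)]
  [TopologicalSpace (TotalSpace F₁ V₁)] [FiberBundle F₁ V₁]
  {F₂ : Type*} [NormedAddCommGroup F₂] [NormedSpace ℂ F₂] {V₂ : X → Type*}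
  [∀ x, TopologicalSpace (V₂ x)] [∀ x, AddCommGroup (V₂ x)] [∀ x, Module ℂ (V₂ x)]
  [TopologicalSpace (TotalSpace F₂ V₂)] [FiberBundle F₂ V₂]
  {F₃ : Type*} [NormedAddCommGroup F₃] [NormedSpace ℂ F₃] {V₃ : X → Type*}
  [∀ x, TopologicalSpace (V₃ x)] [∀ x, AddCommGroup (V₃ x)] [∀ x, Module ℂ (V₃ x)]
  [TopologicalSpace (TotalSpace F₃ V₃)] [FiberBundle F₃ V₃]

theorem HolomorphicallyIsomorphic.symm (h : HolomorphicallyIsomorphic I F₁ V₁ F₂ V₂) :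
    HolomorphicallyIsomorphic I F₂ V₂ F₁ V₁ := by
  obtain ⟨Φ, h1, h2⟩ := h
  exact ⟨fun x => (Φ x).symm, h2, h1⟩

theorem HolomorphicallyIsomorphic.trans (h : HolomorphicallyIsomorphic I F₁ V₁ F₂ V₂)
    (h' : HolomorphicallyIsomorphic I F₂ V₂ F₃ V₃) :
    HolomorphicallyIsomorphic I F₁ V₁ F₃ V₃ := by
  obtain ⟨Φ, h1, h2⟩ := h
  obtain ⟨Ψ, h3, h4⟩ := h'
  exact ⟨fun x => (Φ x).trans (Ψ x), h3.comp h1, h2.comp h4⟩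

variable [VectorBundle ℂ F₁ V₁] [VectorBundle ℂ F₂ V₂]

/-- A fibrewise linear map out of a line bundle is holomorphic near a point where it maps some
nonvanishing local holomorphic section to a holomorphic section. The fibre `F₁` is recognized as
at most one-dimensional by the injective functional `ℓ`. -/
theorem contMDiffAt_totalSpace_map_of_section {ℓ : F₁ →L[ℂ] ℂ} (hℓ : Function.Injective ℓ)
    (Φ : ∀ x, V₁ x →ₗ[ℂ] V₂ x) (p₀ : TotalSpace F₁ V₁) {s : ∀ x, V₁ x} (hs₀ : s p₀.1 ≠ 0)
    (hs : ContMDiffAt I (I.prod 𝓘(ℂ, F₁)) ω (fun x => (⟨x, s x⟩ : TotalSpace F₁ V₁)) p₀.1)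
    (hΦs : ContMDiffAt I (I.prod 𝓘(ℂ, F₂)) ω
      (fun x => (⟨x, Φ x (s x)⟩ : TotalSpace F₂ V₂)) p₀.1) :
    ContMDiffAt (I.prod 𝓘(ℂ, F₁)) (I.prod 𝓘(ℂ, F₂)) ω
      (fun p : TotalSpace F₁ V₁ => (⟨p.1, Φ p.1 p.2⟩ : TotalSpace F₂ V₂)) p₀ := by
  rw [contMDiffAt_totalSpace] at hs hΦs ⊢
  have hproj : ContMDiffAt (I.prod 𝓘(ℂ, F₁)) I ω (fun p : TotalSpace F₁ V₁ => p.1) p₀ :=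
    contMDiffAt_proj V₁
  refine ⟨hproj, ?_⟩
  have hid : ContMDiffAt (I.prod 𝓘(ℂ, F₁)) (I.prod 𝓘(ℂ, F₁)) ω
    (fun p : TotalSpace F₁ V₁ => p) p₀ := contMDiffAt_id
  rw [contMDiffAt_totalSpace] at hid
  set e₁ := trivializationAt F₁ V₁ p₀.1
  set e₂ := trivializationAt F₂ V₂ p₀.1
  have hmem₁ : p₀.1 ∈ e₁.baseSet := FiberBundle.mem_baseSet_trivializationAt' p₀.1
  have hmem₂ : p₀.1 ∈ e₂.baseSet := FiberBundle.mem_baseSet_trivializationAt' p₀.1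
  let t : X → ℂ := fun x => ℓ (e₁ ⟨x, s x⟩).2
  have ht : ContMDiffAt I 𝓘(ℂ) ω t p₀.1 := ℓ.contMDiff.contMDiffAt.comp _ hs.2
  have ht₀ : t p₀.1 ≠ 0 := by
    intro h
    have h1 : (e₁ ⟨p₀.1, s p₀.1⟩).2 = 0 := hℓ (h.trans (map_zero ℓ).symm)
    exact hs₀ ((e₁.linearEquivAt ℂ p₀.1 hmem₁).map_eq_zero_iff.1 h1)
  have ht' : ContMDiffAt (I.prod 𝓘(ℂ, F₁)) 𝓘(ℂ) ω (fun p : TotalSpace F₁ V₁ => t p.1) p₀ :=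
    ht.comp p₀ hproj
  have hc : ContMDiffAt (I.prod 𝓘(ℂ, F₁)) 𝓘(ℂ) ω
      (fun p : TotalSpace F₁ V₁ => ℓ (e₁ p).2 / t p.1) p₀ :=
    ContMDiffAt.div₀ (ℓ.contMDiff.contMDiffAt.comp p₀ hid.2) ht' ht₀
  have hΦs' : ContMDiffAt (I.prod 𝓘(ℂ, F₁)) 𝓘(ℂ, F₂) ω
      (fun p : TotalSpace F₁ V₁ => (e₂ ⟨p.1, Φ p.1 (s p.1)⟩).2) p₀ :=
    ContMDiffAt.comp p₀ (g := fun x => (e₂ ⟨x, Φ x (s x)⟩).2) hΦs.2 hproj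
  refine (hc.smul hΦs').congr_of_eventuallyEq ?_
  filter_upwards [hproj.continuousAt (e₁.open_baseSet.mem_nhds hmem₁),
    hproj.continuousAt (e₂.open_baseSet.mem_nhds hmem₂),
    ht'.continuousAt.eventually_ne ht₀] with p hp₁ hp₂ hp
  have hp_eq : p.2 = (ℓ (e₁ p).2 / t p.1) • s p.1 := by
    apply (e₁.linearEquivAt ℂ p.1 hp₁).injective
    apply hℓ
    rw [map_smul, map_smul, smul_eq_mul]
    exact (div_mul_cancel₀ _ hp).symm
  have h2 : ∀ w, (e₂ ⟨p.1, w⟩).2 = e₂.linearEquivAt ℂ p.1 hp₂ w := fun w => rfl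
  change (e₂ ⟨p.1, Φ p.1 p.2⟩).2 = (ℓ (e₁ p).2 / t p.1) • (e₂ ⟨p.1, Φ p.1 (s p.1)⟩).2
  rw [h2, h2, ← map_smul, ← map_smul, ← hp_eq]

/-- Fibrewise isomorphisms of line bundles form a holomorphic isomorphism as soon as, near each
point, they match some nonvanishing local holomorphic sections. -/
theorem holomorphicallyIsomorphic_of_sections {ℓ₁ : F₁ →L[ℂ] ℂ} (hℓ₁ : Function.Injective ℓ₁)
    {ℓ₂ : F₂ →L[ℂ] ℂ} (hℓ₂ : Function.Injective ℓ₂) (Φ : ∀ x, V₁ x ≃ₗ[ℂ] V₂ x)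
    (h : ∀ x₀ : X, ∃ s : ∀ x, V₁ x, s x₀ ≠ 0 ∧
      ContMDiffAt I (I.prod 𝓘(ℂ, F₁)) ω (fun x => (⟨x, s x⟩ : TotalSpace F₁ V₁)) x₀ ∧
      ContMDiffAt I (I.prod 𝓘(ℂ, F₂)) ω (fun x => (⟨x, Φ x (s x)⟩ : TotalSpace F₂ V₂)) x₀) :
    HolomorphicallyIsomorphic I F₁ V₁ F₂ V₂ := by
  refine ⟨Φ, fun p => ?_, fun p => ?_⟩
  · obtain ⟨s, h0, h1, h2⟩ := h p.1
    exact contMDiffAt_totalSpace_map_of_section hℓ₁ (fun x => (Φ x).toLinearMap) p h0 h1 h2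
  · obtain ⟨s, h0, h1, h2⟩ := h p.1
    refine contMDiffAt_totalSpace_map_of_section hℓ₂ (fun x => (Φ x).symm.toLinearMap) p
      (s := fun x => Φ x (s x)) ((Φ p.1).map_ne_zero_iff.2 h0) h2 ?_
    simpa using h1

end LineBundleMaps

/-! ### Associated line bundles and equivariant sections -/

section EquivariantSections

variable {EX : Type uE} [NormedAddCommGroup EX] [NormedSpace ℂ EX]
  {HX : Type uH} [TopologicalSpace HX] {I : ModelWithCorners ℂ EX HX}
  {X : Type uX} [TopologicalSpace X] [ChartedSpace HX X]
  {EM : Type*} [NormedAddCommGroup EM] [NormedSpace ℂ EM]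
  {HM : Type*} [TopologicalSpace HM] {J : ModelWithCorners ℂ EM HM}
  {M : Type uM} [TopologicalSpace M] [ChartedSpace HM M]
  {EH : Type*} [NormedAddCommGroup EH] [NormedSpace ℂ EH]
  {HH : Type*} [TopologicalSpace HH] {K : ModelWithCorners ℂ EH HH}
  {H : Type*} [Group H] [TopologicalSpace H] [ChartedSpace HH H]
  [MulAction Hᵐᵒᵖ M] {p : M → X}

theorem IsPrincipalTrivialization.smul_symm {e : Trivialization H p}
    (he : IsPrincipalTrivialization I J K e) (hp : IsPrincipalBundle I J K H p) {x : X}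
    (hx : x ∈ e.baseSet) (g h : H) :
    op h • e.toOpenPartialHomeomorph.symm (x, g) = e.toOpenPartialHomeomorph.symm (x, g * h) := by
  have hs : ∀ k : H, e.toOpenPartialHomeomorph.symm (x, k) ∈ e.source := fun k =>
    e.map_target (e.mem_target.2 hx)
  have hs' : op h • e.toOpenPartialHomeomorph.symm (x, g) ∈ e.source := by
    rw [e.mem_source, hp.proj_smul, e.proj_symm_apply' hx]; exact hx
  apply e.injOn hs' (hs _)
  change e (op h • e.toOpenPartialHomeomorph.symm (x, g)) =
    e (e.toOpenPartialHomeomorph.symm (x, g * h))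
  rw [e.apply_symm_apply' hx]
  refine Prod.ext ?_ ?_
  · rw [e.coe_fst hs', hp.proj_smul, e.proj_symm_apply' hx]
  · rw [he.equivariant _ (hs g), e.apply_symm_apply' hx]

theorem IsPrincipalTrivialization.smul_unit_point {e : Trivialization H p}
    (he : IsPrincipalTrivialization I J K e) (hp : IsPrincipalBundle I J K H p) {x : X}
    (hx : x ∈ e.baseSet) {m : M} (hm : p m = x) :
    op (e m).2 • e.toOpenPartialHomeomorph.symm (x, 1) = m := by
  have hms : m ∈ e.source := by rw [e.mem_source, hm]; exact hx
  rw [he.smul_symm hp hx, one_mul, ← hm, ← e.coe_fst hms]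
  exact e.left_inv hms

namespace AssocFiber

variable (hp : IsPrincipalBundle I J K H p) (χ : HolomorphicCharacter K H)

/-- The class `[m, v]` of the pair `(m, v)`, as a vector in the fibre of the line bundle
`M ×_H ℂ_χ`. -/
def fiberMk {x : X} (m : M) (hm : p m = x) (v : ℂ) : (associatedLineBundle hp χ).Fiber x :=
  mk hp χ m hm v

/-- The class of the pair `(m, v)` as a point of the total space of `M ×_H ℂ_χ`. -/
def totalMk (m : M) (v : ℂ) : TotalSpace ℂ (associatedLineBundle hp χ).Fiber :=
  ⟨p m, fiberMk hp χ m rfl v⟩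

theorem totalMk_eq {x : X} {m : M} (hm : p m = x) (v : ℂ) :
    totalMk hp χ m v = ⟨x, fiberMk hp χ m hm v⟩ := by
  subst hm; rfl

theorem fiberMk_mul {x : X} (m : M) (hm : p m = x) (c v : ℂ) :
    fiberMk hp χ m hm (c * v) = c • fiberMk hp χ m hm v :=
  mk_smul hp χ m hm c v

theorem fiberMk_ne_zero {x : X} (m : M) (hm : p m = x) {v : ℂ} (hv : v ≠ 0) :
    fiberMk hp χ m hm v ≠ 0 := by
  have he := trivAt_principal hp x
  have hmem := mem_trivAt hp x
  have hcoord : ∀ w, coord hp χ (trivAt hp x) (fiberMk hp χ m hm w) =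
      ((χ (trivAt hp x m).2 : ℂˣ) : ℂ) * w := fun w => coord_mk he hmem m hm w
  have h0 : fiberMk hp χ m hm 0 = 0 := by
    have := fiberMk_mul hp χ m hm 0 0
    rwa [zero_mul, zero_smul] at this
  intro h
  have h1 := hcoord v
  rw [h, ← h0, hcoord 0, mul_zero] at h1
  exact mul_ne_zero (Units.ne_zero _) hv h1.symm

theorem fiberMk_smul {x : X} (m : M) (hm : p m = x) (h : H) (v : ℂ) :
    fiberMk hp χ (op h • m) ((hp.proj_smul h m).trans hm) v =
      fiberMk hp χ m hm (((χ h : ℂˣ) : ℂ) * v) := by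
  refine Quotient.sound (s := assocSetoid p χ x) ⟨h, ?_, rfl⟩
  rw [smul_smul, ← op_mul, mul_inv_cancel, op_one, one_smul]

variable {EY : Type*} [NormedAddCommGroup EY] [NormedSpace ℂ EY]
  {HY : Type*} [TopologicalSpace HY] {IY : ModelWithCorners ℂ EY HY}
  {Y : Type*} [TopologicalSpace Y] [ChartedSpace HY Y]

theorem contMDiffAt_totalMk {m : Y → M} {v : Y → ℂ} {y₀ : Y} (hm : ContMDiffAt IY J ω m y₀)
    (hv : ContMDiffAt IY 𝓘(ℂ) ω v y₀) :
    ContMDiffAt IY (I.prod 𝓘(ℂ)) ω (fun y => totalMk hp χ (m y) (v y)) y₀ := by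
  have hpm : ContMDiffAt IY I ω (fun y => p (m y)) y₀ :=
    hp.holomorphic_proj.contMDiffAt.comp y₀ hm
  rw [contMDiffAt_totalSpace]
  refine ⟨hpm, ?_⟩
  have he := trivAt_principal hp (p (m y₀))
  have hmem := mem_trivAt hp (p (m y₀))
  have hms : m y₀ ∈ (trivAt hp (p (m y₀))).source :=
    (trivAt hp (p (m y₀))).mem_source.2 hmem
  have h1 : ContMDiffAt IY (I.prod K) ω (fun y => trivAt hp (p (m y₀)) (m y)) y₀ :=
    (he.holomorphic.contMDiffAt ((trivAt hp (p (m y₀))).open_source.mem_nhds hms)).comp y₀ hm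
  have h2 : ContMDiffAt IY K ω (fun y => (trivAt hp (p (m y₀)) (m y)).2) y₀ :=
    contMDiffAt_snd.comp y₀ h1
  have h3 : ContMDiff K 𝓘(ℂ) ω (fun h : H => ((χ h : ℂˣ) : ℂ)) :=
    Units.contMDiff_val.comp χ.contMDiff_toFun
  refine ((h3.contMDiffAt.comp y₀ h2).mul hv).congr_of_eventuallyEq ?_
  filter_upwards [hpm.continuousAt ((trivAt hp (p (m y₀))).open_baseSet.mem_nhds hmem)] with y hy
  exact coord_mk (hp := hp) (χ := χ) he hy (m y) rfl (v y)

end AssocFiber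

section

variable {F : Type*} [NormedAddCommGroup F] [NormedSpace ℂ F] {V : X → Type*}
  [∀ x, TopologicalSpace (V x)] [∀ x, AddCommGroup (V x)] [∀ x, Module ℂ (V x)]
  [TopologicalSpace (TotalSpace F V)] [FiberBundle F V]

variable (F) in
/-- A nowhere vanishing holomorphic section of the pullback of the bundle `V` to the principal
bundle `p : M → X` which transforms under the character `ψ`: a vector `β_m ∈ V_{p(m)}` for each
`m ∈ M`, with `β_{mh} = ψ(h) β_m`. The point `x = p(m)` is a separate argument of `β`, so that
`β_{mh}` and `β_m` lie in the same fibre on the nose. -/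
structure IsEquivariantSection (hp : IsPrincipalBundle I J K H p) (ψ : HolomorphicCharacter K H)
    (β : ∀ (m : M) (x : X), p m = x → V x) : Prop where
  holomorphic : ContMDiff J (I.prod 𝓘(ℂ, F)) ω (fun m => (⟨p m, β m (p m) rfl⟩ : TotalSpace F V))
  nowhere_zero : ∀ m x hx, β m x hx ≠ 0
  equivariant : ∀ m x hx (h : H),
    β (op h • m) x ((hp.proj_smul h m).trans hx) = ((ψ h : ℂˣ) : ℂ) • β m x hx

/-- An isomorphism `Φ` from `V` to the associated bundle gives the equivariant section
`β_m = Φ⁻¹ [m, 1]`. -/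
theorem exists_isEquivariantSection {hp : IsPrincipalBundle I J K H p}
    {ψ : HolomorphicCharacter K H}
    (h : HolomorphicallyIsomorphic I F V ℂ (associatedLineBundle hp ψ).Fiber) :
    ∃ β : ∀ (m : M) (x : X), p m = x → V x, IsEquivariantSection F hp ψ β := by
  obtain ⟨Φ, -, hΦ⟩ := h
  refine ⟨fun m x hx => (Φ x).symm (AssocFiber.fiberMk hp ψ m hx 1), ?_, ?_, ?_⟩
  · have h1 : ContMDiff J (I.prod 𝓘(ℂ)) ω (fun m => AssocFiber.totalMk hp ψ m 1) := fun m =>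
      AssocFiber.contMDiffAt_totalMk hp ψ contMDiffAt_id contMDiffAt_const
    exact hΦ.comp h1
  · intro m x hx h0
    exact AssocFiber.fiberMk_ne_zero hp ψ m hx one_ne_zero ((Φ x).symm.map_eq_zero_iff.1 h0)
  · intro m x hx h
    rw [← map_smul, ← AssocFiber.fiberMk_mul, AssocFiber.fiberMk_smul]

variable [VectorBundle ℂ F V]

/-- An equivariant section of the pullback of a line bundle `V` identifies `V` with the associated
bundle, by `[m, v] ↦ v β_m`. -/
theorem IsEquivariantSection.holomorphicallyIsomorphic {hp : IsPrincipalBundle I J K H p}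
    {ψ : HolomorphicCharacter K H} {β : ∀ (m : M) (x : X), p m = x → V x}
    (hβ : IsEquivariantSection F hp ψ β) {ℓ : F →L[ℂ] ℂ} (hℓ : Function.Injective ℓ) :
    HolomorphicallyIsomorphic I F V ℂ (associatedLineBundle hp ψ).Fiber := by
  -- `b x` is `β` at the point over `x` with coordinate `1` in the trivialization around `x`; this
  -- point does not depend holomorphically on `x`, so `b` serves only to define the map fibrewise.
  let b : ∀ x, V x := fun x =>
    β _ x (AssocFiber.exists_unit_point (AssocFiber.trivAt hp x) (AssocFiber.mem_trivAt hp x))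
  let Ψ : ∀ x, (associatedLineBundle hp ψ).Fiber x →ₗ[ℂ] V x := fun x =>
    { toFun := fun q => AssocFiber.coord hp ψ (AssocFiber.trivAt hp x) q • b x
      map_add' := fun q r => by
        have : AssocFiber.coord hp ψ (AssocFiber.trivAt hp x) (q + r) =
          AssocFiber.coord hp ψ (AssocFiber.trivAt hp x) q +
          AssocFiber.coord hp ψ (AssocFiber.trivAt hp x) r :=
            (AssocFiber.coordEquiv hp ψ x).apply_symm_apply _
        rw [this, add_smul]
      map_smul' := fun c q => by
        have : AssocFiber.coord hp ψ (AssocFiber.trivAt hp x) (c • q) =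
          c * AssocFiber.coord hp ψ (AssocFiber.trivAt hp x) q :=
            (AssocFiber.coordEquiv hp ψ x).apply_symm_apply _
        rw [this, mul_smul, RingHom.id_apply] }
  have hΨ : ∀ (m : M) (x : X) (hx : p m = x) (v : ℂ),
      Ψ x (AssocFiber.fiberMk hp ψ m hx v) = v • β m x hx := by
    intro m x hx v
    change AssocFiber.coord hp ψ (AssocFiber.trivAt hp x) (AssocFiber.mk hp ψ m hx v) • b x = _
    have he := AssocFiber.trivAt_principal hp x
    have hmem := AssocFiber.mem_trivAt hp x
    rw [AssocFiber.coord_mk he hmem, mul_comm, mul_smul, ← hβ.equivariant]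
    congr 2
    exact he.smul_unit_point hp hmem hx
  have hb : ∀ x, b x ≠ 0 := fun x => hβ.nowhere_zero _ _ _
  have hbij : ∀ x, Function.Bijective (Ψ x) := by
    intro x
    refine ⟨fun q r hqr => ?_, fun w => ?_⟩
    · exact (AssocFiber.coordEquiv hp ψ x).injective (smul_left_injective ℂ (hb x) hqr)
    · have hmem : x ∈ (trivializationAt F V x).baseSet :=
        FiberBundle.mem_baseSet_trivializationAt' x
      let L := (trivializationAt F V x).linearEquivAt ℂ x hmem
      have hLb : ℓ (L (b x)) ≠ 0 := fun h =>
        hb x (L.map_eq_zero_iff.1 (hℓ (h.trans (map_zero ℓ).symm)))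
      refine ⟨(AssocFiber.coordEquiv hp ψ x).symm (ℓ (L w) / ℓ (L (b x))), ?_⟩
      change (AssocFiber.coordEquiv hp ψ x ((AssocFiber.coordEquiv hp ψ x).symm _)) • b x = w
      rw [Equiv.apply_symm_apply]
      apply L.injective
      apply hℓ
      rw [map_smul, map_smul, smul_eq_mul, div_mul_cancel₀ _ hLb]
  -- Holomorphy: near `x₀` the section `[σ, 1]` corresponds to `β ∘ σ`, where `σ` is the unit
  -- section of `M` in one fixed trivialization.
  refine HolomorphicallyIsomorphic.symm (holomorphicallyIsomorphic_of_sections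
    (ℓ₁ := ContinuousLinearMap.id ℂ ℂ) Function.injective_id hℓ
    (fun x => LinearEquiv.ofBijective (Ψ x) (hbij x)) fun x₀ => ?_)
  classical
  set e := AssocFiber.trivAt hp x₀
  have he : IsPrincipalTrivialization I J K e := AssocFiber.trivAt_principal hp x₀
  have hmem : x₀ ∈ e.baseSet := AssocFiber.mem_trivAt hp x₀
  let s : ∀ x, (associatedLineBundle hp ψ).Fiber x := fun x =>
    if hx : x ∈ e.baseSet then AssocFiber.fiberMk hp ψ _ (AssocFiber.exists_unit_point e hx) 1
    else 0
  have hσ : ContMDiffAt I J ω (fun x => e.toOpenPartialHomeomorph.symm (x, (1 : H))) x₀ :=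
    (he.holomorphic_symm.contMDiffAt (e.open_target.mem_nhds (e.mem_target.2 hmem))).comp x₀
      (contMDiffAt_id.prodMk contMDiffAt_const)
  have hs : ∀ x (hx : x ∈ e.baseSet), Ψ x (s x) =
      β _ x (AssocFiber.exists_unit_point e hx) := by
    intro x hx
    simp only [s, dif_pos hx]
    rw [hΨ, one_smul]
  refine ⟨s, fun h0 => ?_, ?_, ?_⟩
  · have := hs x₀ hmem
    rw [h0, map_zero] at this
    exact hβ.nowhere_zero _ _ _ this.symm
  · refine (AssocFiber.contMDiffAt_totalMk hp ψ hσ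
      (contMDiffAt_const (c := (1 : ℂ)))).congr_of_eventuallyEq ?_
    filter_upwards [e.open_baseSet.mem_nhds hmem] with x hx
    rw [AssocFiber.totalMk_eq hp ψ (AssocFiber.exists_unit_point e hx)]
    simp only [s, dif_pos hx]
  · refine (hβ.holomorphic.contMDiffAt.comp x₀ hσ).congr_of_eventuallyEq ?_
    filter_upwards [e.open_baseSet.mem_nhds hmem] with x hx
    change (⟨x, Ψ x (s x)⟩ : TotalSpace F V) = ⟨_, _⟩
    rw [hs x hx]
    have : ∀ (m : M) (hm : p m = x), (⟨x, β m x hm⟩ : TotalSpace F V) = ⟨p m, β m (p m) rfl⟩ := by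
      rintro m rfl; rfl
    exact this _ _

end

end EquivariantSections

/-! ### Contraction of top forms -/

section Contraction

variable {T V W : Type*} [NormedAddCommGroup T] [NormedSpace ℂ T]
  [NormedAddCommGroup V] [NormedSpace ℂ V]
  [NormedAddCommGroup W] [NormedSpace ℂ W]

variable (V) in
/-- Evaluation of top forms on a basis. -/
def canonicalModelEval [FiniteDimensional ℂ V] : CanonicalModel V →L[ℂ] ℂ :=
  ContinuousAlternatingMap.apply ℂ V ℂ (Module.finBasis ℂ V)

theorem canonicalModelEval_injective [FiniteDimensional ℂ V] :
    Function.Injective (canonicalModelEval V) := by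
  intro f g h
  rw [canonicalModel_eq_smul f, canonicalModel_eq_smul g]
  exact congrArg (· • _) h

/-- `β` is the contraction of the top form `Ω` on `T` with a basis of `W`, where `A : W → T` and
`P : T → V` form a short exact sequence: the top form on `V` with
`Ω (u₁, …, uₙ, A e₁, …, A eₖ) = β (P u₁, …, P uₙ)`. The bijection `σ` splits the arguments
of `Ω`. -/
def IsContraction [FiniteDimensional ℂ W]
    (σ : Fin (Module.finrank ℂ T) ≃ Fin (Module.finrank ℂ V) ⊕ Fin (Module.finrank ℂ W))
    (P : T →L[ℂ] V) (A : W →L[ℂ] T) (Ω : CanonicalModel T) (β : CanonicalModel V) : Prop :=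
  ∀ u : Fin (Module.finrank ℂ V) → T,
    Ω (Sum.elim u (A ∘ Module.finBasis ℂ W) ∘ σ) = β (P ∘ u)

variable {σ : Fin (Module.finrank ℂ T) ≃ Fin (Module.finrank ℂ V) ⊕ Fin (Module.finrank ℂ W)}
  {P : T →L[ℂ] V} {A : W →L[ℂ] T}

theorem exists_lift_finBasis [FiniteDimensional ℂ V] (hP : Function.Surjective P) :
    ∃ w : Fin (Module.finrank ℂ V) → T, ∀ i, P (w i) = Module.finBasis ℂ V i :=
  ⟨fun _ => (hP _).choose, fun _ => (hP _).choose_spec⟩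

theorem exists_comp_eq (hP : Function.Surjective P) (t : Fin (Module.finrank ℂ V) → V) :
    ∃ u : Fin (Module.finrank ℂ V) → T, P ∘ u = t :=
  ⟨fun i => (hP (t i)).choose, funext fun i => (hP (t i)).choose_spec⟩

theorem card_sum_eq_finrank
    (σ : Fin (Module.finrank ℂ T) ≃ Fin (Module.finrank ℂ V) ⊕ Fin (Module.finrank ℂ W)) :
    Fintype.card (Fin (Module.finrank ℂ V) ⊕ Fin (Module.finrank ℂ W)) =
    Module.finrank ℂ T := by
  rw [← Fintype.card_congr σ, Fintype.card_fin]

theorem form_apply_sumElim [FiniteDimensional ℂ V] [FiniteDimensional ℂ W]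
    (hA : Function.Injective A) (hPA : ∀ z, P (A z) = 0)
    {w : Fin (Module.finrank ℂ V) → T} (hw : ∀ i, P (w i) = Module.finBasis ℂ V i)
    (Ω : CanonicalModel T) (u : Fin (Module.finrank ℂ V) → T)
    (y : Fin (Module.finrank ℂ W) → W) :
    Ω (Sum.elim u (A ∘ y) ∘ σ) = Ω (Sum.elim w (A ∘ Module.finBasis ℂ W) ∘ σ) *
    ((Module.finBasis ℂ V).det (P ∘ u) * (Module.finBasis ℂ W).det y) :=
  map_sumElim_eq_mul_det (Module.finBasis ℂ V) (Module.finBasis ℂ W) P.toLinearMap A.toLinearMap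
    hA hPA hw (card_sum_eq_finrank σ)
    (AlternatingMap.domDomCongr σ Ω.toAlternatingMap) u y

/-- Changing the basis of `W` by `L` multiplies contractions by `det L`. -/
theorem form_apply_sumElim_comp [FiniteDimensional ℂ V] [FiniteDimensional ℂ W]
    (hP : Function.Surjective P) (hA : Function.Injective A)
    (hPA : ∀ z, P (A z) = 0) (L : W →L[ℂ] W) (Ω : CanonicalModel T)
    (u : Fin (Module.finrank ℂ V) → T) :
    Ω (Sum.elim u (A ∘ L ∘ Module.finBasis ℂ W) ∘ σ) =
      LinearMap.det (L : W →ₗ[ℂ] W) * Ω (Sum.elim u (A ∘ Module.finBasis ℂ W) ∘ σ) := by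
  obtain ⟨w, hw⟩ := exists_lift_finBasis hP
  have h := (Module.finBasis ℂ W).det_comp (L : W →ₗ[ℂ] W) (Module.finBasis ℂ W)
  rw [Module.Basis.det_self, mul_one] at h
  rw [form_apply_sumElim hA hPA hw Ω u (L ∘ Module.finBasis ℂ W),
    form_apply_sumElim hA hPA hw Ω u (Module.finBasis ℂ W), Module.Basis.det_self, mul_one]
  erw [h]
  ring

theorem exists_contraction [FiniteDimensional ℂ V] [FiniteDimensional ℂ W]
    (hP : Function.Surjective P) (hA : Function.Injective A)
    (hPA : ∀ z, P (A z) = 0) (Ω : CanonicalModel T) : ∃ β, IsContraction σ P A Ω β := by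
  obtain ⟨w, hw⟩ := exists_lift_finBasis hP
  refine ⟨Ω (Sum.elim w (A ∘ Module.finBasis ℂ W) ∘ σ) • detForm (Module.finBasis ℂ V),
    fun u => ?_⟩
  rw [form_apply_sumElim hA hPA hw Ω u (Module.finBasis ℂ W), Module.Basis.det_self, mul_one]
  rfl

/-- An adapted frame evaluates nontrivially under a nonzero top form. -/
theorem detForm_sumElim_ne_zero [FiniteDimensional ℂ T] [FiniteDimensional ℂ V]
    [FiniteDimensional ℂ W]
    (hA : Function.Injective A) (hPA : ∀ z, P (A z) = 0)
    {w : Fin (Module.finrank ℂ V) → T} (hw : ∀ i, P (w i) = Module.finBasis ℂ V i) :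
    detForm (Module.finBasis ℂ T) (Sum.elim w (A ∘ Module.finBasis ℂ W) ∘ σ) ≠ 0 := by
  have hξ : LinearIndependent ℂ (A ∘ Module.finBasis ℂ W) :=
    (Module.finBasis ℂ W).linearIndependent.map' A.toLinearMap (LinearMap.ker_eq_bot.2 hA)
  have hli : LinearIndependent ℂ (Sum.elim w (A ∘ Module.finBasis ℂ W) ∘ σ) :=
    (linearIndependent_sumElim_of_lift (Module.finBasis ℂ V).linearIndependent P.toLinearMap hξ
    (fun j => hPA _) hw).comp σ σ.injective
  exact IsUnit.ne_zero ((Module.Basis.is_basis_iff_det _).1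
    ⟨hli, hli.span_eq_top_of_card_eq_finrank' (by simp)⟩)

theorem exists_form_of_contraction [FiniteDimensional ℂ T] [FiniteDimensional ℂ V]
    [FiniteDimensional ℂ W]
    (hP : Function.Surjective P) (hA : Function.Injective A)
    (hPA : ∀ z, P (A z) = 0) (β : CanonicalModel V) : ∃ Ω, IsContraction σ P A Ω β := by
  obtain ⟨w, hw⟩ := exists_lift_finBasis hP
  have hne := detForm_sumElim_ne_zero (σ := σ) hA hPA hw
  refine ⟨(β (Module.finBasis ℂ V) /
    detForm (Module.finBasis ℂ T) (Sum.elim w (A ∘ Module.finBasis ℂ W) ∘ σ)) •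
      detForm (Module.finBasis ℂ T), fun u => ?_⟩
  rw [form_apply_sumElim hA hPA hw _ u (Module.finBasis ℂ W), Module.Basis.det_self, mul_one,
    ContinuousAlternatingMap.smul_apply, smul_eq_mul, div_mul_cancel₀ _ hne]
  conv_rhs => rw [canonicalModel_eq_smul β]
  rfl

theorem IsContraction.smul [FiniteDimensional ℂ W] {Ω : CanonicalModel T} {β : CanonicalModel V}
    (h : IsContraction σ P A Ω β) (c : ℂ) : IsContraction σ P A (c • Ω) (c • β) := fun u => by
  rw [ContinuousAlternatingMap.smul_apply, h u, ContinuousAlternatingMap.smul_apply]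

theorem IsContraction.right_unique [FiniteDimensional ℂ W] (hP : Function.Surjective P)
    {Ω : CanonicalModel T}
    {β β' : CanonicalModel V} (h : IsContraction σ P A Ω β) (h' : IsContraction σ P A Ω β') :
    β = β' := by
  ext t
  obtain ⟨u, rfl⟩ := exists_comp_eq hP t
  exact (h u).symm.trans (h' u)

theorem IsContraction.left_unique [FiniteDimensional ℂ T] [FiniteDimensional ℂ V]
    [FiniteDimensional ℂ W]
    (hP : Function.Surjective P) (hA : Function.Injective A)
    (hPA : ∀ z, P (A z) = 0) {Ω Ω' : CanonicalModel T} {β : CanonicalModel V}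
    (h : IsContraction σ P A Ω β) (h' : IsContraction σ P A Ω' β) : Ω = Ω' := by
  obtain ⟨w, hw⟩ := exists_lift_finBasis hP
  have hne := detForm_sumElim_ne_zero (σ := σ) hA hPA hw
  have h1 := (h w).trans (h' w).symm
  rw [canonicalModel_eq_smul Ω, canonicalModel_eq_smul Ω',
    ContinuousAlternatingMap.smul_apply, ContinuousAlternatingMap.smul_apply] at h1
  rw [canonicalModel_eq_smul Ω, canonicalModel_eq_smul Ω', smul_left_injective ℂ hne h1]

theorem IsContraction.ne_zero_iff [FiniteDimensional ℂ T] [FiniteDimensional ℂ V]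
    [FiniteDimensional ℂ W]
    (hP : Function.Surjective P) (hA : Function.Injective A)
    (hPA : ∀ z, P (A z) = 0) {Ω : CanonicalModel T} {β : CanonicalModel V}
    (h : IsContraction σ P A Ω β) : Ω ≠ 0 ↔ β ≠ 0 := by
  have h0 : IsContraction σ P A 0 0 := fun u => rfl
  refine not_congr ⟨fun hΩ => ?_, fun hβ => ?_⟩
  · subst hΩ; exact h.right_unique hP h0
  · subst hβ; exact h.left_unique hP hA hPA h0

end Contraction

/-! ### Infinitesimal geometry of principal bundles -/

section ModelDerivative

variable {E₁ : Type*} [NormedAddCommGroup E₁] [NormedSpace ℂ E₁]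
  {H₁ : Type*} [TopologicalSpace H₁] (I₁ : ModelWithCorners ℂ E₁ H₁)
  {M₁ : Type*} [TopologicalSpace M₁] [ChartedSpace H₁ M₁]
  {E₂ : Type*} [NormedAddCommGroup E₂] [NormedSpace ℂ E₂]
  {H₂ : Type*} [TopologicalSpace H₂] (I₂ : ModelWithCorners ℂ E₂ H₂)
  {M₂ : Type*} [TopologicalSpace M₂] [ChartedSpace H₂ M₂]
  {E₃ : Type*} [NormedAddCommGroup E₃] [NormedSpace ℂ E₃]
  {H₃ : Type*} [TopologicalSpace H₃] (I₃ : ModelWithCorners ℂ E₃ H₃)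
  {M₃ : Type*} [TopologicalSpace M₃] [ChartedSpace H₃ M₃]

/-- The differential of `f` at `x`, as a map between the model spaces, to which all tangent spaces
are definitionally equal. In this form the differentials at propositionally equal points can be
compared. -/
def modelDeriv (f : M₁ → M₂) (x : M₁) : E₁ →L[ℂ] E₂ := mfderiv I₁ I₂ f x

theorem modelDeriv_comp {g : M₂ → M₃} {f : M₁ → M₂} {x : M₁} {y : M₂} (hy : f x = y)
    (hg : MDifferentiableAt I₂ I₃ g y) (hf : MDifferentiableAt I₁ I₂ f x) :
    modelDeriv I₁ I₃ (g ∘ f) x = (modelDeriv I₂ I₃ g y).comp (modelDeriv I₁ I₂ f x) := by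
  subst hy
  exact mfderiv_comp x hg hf

theorem modelDeriv_const (c : M₂) (x : M₁) : modelDeriv I₁ I₂ (fun _ : M₁ => c) x = 0 :=
  mfderiv_const

theorem modelDeriv_id (x : M₁) : modelDeriv I₁ I₁ (fun y : M₁ => y) x = .id ℂ E₁ :=
  mfderiv_id

variable {I₁ I₂} in
theorem modelDeriv_congr {f g : M₁ → M₂} {x : M₁} (h : f =ᶠ[𝓝 x] g) :
    modelDeriv I₁ I₂ f x = modelDeriv I₁ I₂ g x :=
  h.mfderiv_eq

/-- A left inverse of `f` near `x` gives a left inverse of the differential. -/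
theorem modelDeriv_comp_eq_id {g : M₂ → M₁} {f : M₁ → M₂} {x : M₁} {y : M₂} (hy : f x = y)
    (hg : MDifferentiableAt I₂ I₁ g y) (hf : MDifferentiableAt I₁ I₂ f x)
    (h : ∀ᶠ z in 𝓝 x, g (f z) = z) (v : E₁) :
    modelDeriv I₂ I₁ g y (modelDeriv I₁ I₂ f x v) = v := by
  have h1 := modelDeriv_comp I₁ I₂ I₁ hy hg hf
  rw [modelDeriv_congr (f := g ∘ f) (g := fun z => z) h, modelDeriv_id] at h1
  exact congrArg (fun L => L v) h1.symm

end ModelDerivative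

section Adjoint

variable {EH : Type*} [NormedAddCommGroup EH] [NormedSpace ℂ EH]
  {HH : Type*} [TopologicalSpace HH] (K : ModelWithCorners ℂ EH HH)
  {H : Type*} [Group H] [TopologicalSpace H] [ChartedSpace HH H]

/-- The adjoint representation `Ad_h : T₁H → T₁H`. -/
def adjointMap (h : H) : EH →L[ℂ] EH := modelDeriv K K (fun g : H => h * g * h⁻¹) 1

theorem adjointMap_one : adjointMap K (1 : H) = .id ℂ EH := by
  rw [← modelDeriv_id K (1 : H), adjointMap]
  congr 1
  funext g
  simp

variable [LieGroup K ω H]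

theorem contMDiff_conj (h : H) : ContMDiff K K ω (fun g : H => h * g * h⁻¹) :=
  (contMDiff_const.mul contMDiff_id).mul contMDiff_const

theorem adjointMap_mul (h k : H) :
    adjointMap K (h * k) = (adjointMap K h).comp (adjointMap K k) := by
  have h1 := modelDeriv_comp K K K (x := (1 : H)) (y := 1) (f := fun g : H => k * g * k⁻¹)
    (g := fun g : H => h * g * h⁻¹) (by simp)
    ((contMDiff_conj K h).mdifferentiableAt (by simp))
    ((contMDiff_conj K k).mdifferentiableAt (by simp))
  rw [adjointMap, adjointMap, adjointMap, ← h1]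
  congr 1
  funext g
  simp [mul_assoc]

variable [FiniteDimensional ℂ EH]

theorem contMDiff_det_adjointMap :
    ContMDiff K 𝓘(ℂ) ω (fun h : H => LinearMap.det (adjointMap K h : EH →ₗ[ℂ] EH)) := by
  intro h₀
  have hV : ∀ i, ContMDiffAt K (K.prod 𝓘(ℂ, EH)) ω (fun h : H =>
      (⟨1, adjointMap K h (Module.finBasis ℂ EH i)⟩ :
        TotalSpace EH (TangentSpace K : H → Type _))) h₀ := by
    intro i
    have hF : ContMDiffAt (K.prod K) K ω (Function.uncurry fun h g : H => h * g * h⁻¹) (h₀, 1) :=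
      ((contMDiff_fst.mul contMDiff_snd).mul contMDiff_fst.inv).contMDiffAt
    have h1 := contMDiffAt_mfderiv_apply (fun h g : H => h * g * h⁻¹) (fun _ => (1 : H))
      (fun _ => Module.finBasis ℂ EH i) hF contMDiffAt_const
    refine h1.congr_of_eventuallyEq (Filter.Eventually.of_forall fun h => ?_)
    exact TotalSpace.ext (by simp) HEq.rfl
  have hβ : ContMDiffAt K (K.prod 𝓘(ℂ, CanonicalModel EH)) ω (fun _ : H =>
      (⟨1, (detForm (Module.finBasis ℂ EH) : CanonicalModel EH)⟩ :
        TotalSpace (CanonicalModel EH) (fun h : H => CanonicalFiber K h))) h₀ := contMDiffAt_const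
  refine (contMDiffAt_form_apply hβ hV).congr_of_eventuallyEq
    (Filter.Eventually.of_forall fun h => ?_)
  have h := (Module.finBasis ℂ EH).det_comp (adjointMap K h : EH →ₗ[ℂ] EH) (Module.finBasis ℂ EH)
  rw [Module.Basis.det_self, mul_one] at h
  exact h.symm

variable (H) in
/-- The holomorphic character `h ↦ det Ad_h`. -/
def detAdjoint : HolomorphicCharacter K H where
  toMonoidHom := MonoidHom.toHomUnits
    { toFun := fun h : H => LinearMap.det (adjointMap K h : EH →ₗ[ℂ] EH)
      map_one' := by
        rw [adjointMap_one]
        exact LinearMap.det_id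
      map_mul' := fun h k => by
        rw [adjointMap_mul]
        exact LinearMap.det_comp _ _ }
  contMDiff_toFun := ContMDiff.of_comp_isOpenEmbedding Units.isOpenEmbedding_val
    (contMDiff_det_adjointMap K)

theorem coe_detAdjoint (h : H) :
    ((detAdjoint K H h : ℂˣ) : ℂ) = LinearMap.det (adjointMap K h : EH →ₗ[ℂ] EH) := rfl

end Adjoint

section Geometry

variable {EX : Type uE} [NormedAddCommGroup EX] [NormedSpace ℂ EX]
  {HX : Type uH} [TopologicalSpace HX] {I : ModelWithCorners ℂ EX HX}
  {X : Type uX} [TopologicalSpace X] [ChartedSpace HX X]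
  {EM : Type*} [NormedAddCommGroup EM] [NormedSpace ℂ EM]
  {HM : Type*} [TopologicalSpace HM] {J : ModelWithCorners ℂ EM HM}
  {M : Type uM} [TopologicalSpace M] [ChartedSpace HM M]
  {EH : Type*} [NormedAddCommGroup EH] [NormedSpace ℂ EH]
  {HH : Type*} [TopologicalSpace HH] {K : ModelWithCorners ℂ EH HH}
  {H : Type*} [Group H] [TopologicalSpace H] [ChartedSpace HH H]
  [MulAction Hᵐᵒᵖ M] {p : M → X}

variable (J K H) in
/-- The differential at `1` of the orbit map `h ↦ m h`, whose values are the values at `m` of the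
fundamental vector fields of the action. -/
def orbitDeriv (m : M) : EH →L[ℂ] EM := modelDeriv K J (fun h : H => op h • m) 1

variable (J) in
/-- The differential of the right translation `R_h` at `m`. -/
def translateDeriv (h : H) (m : M) : EM →L[ℂ] EM := modelDeriv J J (fun m : M => op h • m) m

namespace IsPrincipalBundle

variable (hp : IsPrincipalBundle I J K H p)
include hp

theorem contMDiff_orbit (m : M) : ContMDiff K J ω (fun h : H => op h • m) :=
  hp.holomorphic_action.comp (contMDiff_const.prodMk contMDiff_id)

theorem contMDiff_translate (h : H) : ContMDiff J J ω (fun m : M => op h • m) :=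
  hp.holomorphic_action.comp (contMDiff_id.prodMk contMDiff_const)

theorem contMDiff_orbitDeriv [IsManifold J ω M] [LieGroup K ω H] (z : EH) :
    ContMDiff J (J.prod 𝓘(ℂ, EM)) ω (fun m : M =>
      (⟨m, orbitDeriv J K H m z⟩ : TotalSpace EM (TangentSpace J : M → Type _))) := by
  intro m₀
  have h1 := contMDiffAt_mfderiv_apply (fun (m : M) (h : H) => op h • m) (fun _ => (1 : H))
    (fun _ => z) (y₀ := m₀) (hp.holomorphic_action.contMDiffAt) contMDiffAt_const
  refine h1.congr_of_eventuallyEq (Filter.Eventually.of_forall fun m => ?_)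
  exact TotalSpace.ext (by simp) HEq.rfl

theorem proj_orbitDeriv (m : M) (z : EH) :
    modelDeriv J I p m (orbitDeriv J K H m z) = 0 := by
  have h1 := modelDeriv_comp K J I (x := (1 : H)) (f := fun h : H => op h • m) (g := p)
    (y := m) (by simp) (hp.holomorphic_proj.mdifferentiableAt (by simp))
    ((hp.contMDiff_orbit m).mdifferentiableAt (by simp))
  have h2 : p ∘ (fun h : H => op h • m) = fun _ => p m := funext fun h => hp.proj_smul h m
  rw [h2, modelDeriv_const] at h1
  exact congrArg (fun L => L z) h1.symm

theorem injective_orbitDeriv [LieGroup K ω H] (m : M) :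
    Function.Injective (orbitDeriv J K H m) := by
  obtain ⟨e, he, hm⟩ := hp.exists_trivialization (p m)
  have hms : m ∈ e.source := e.mem_source.2 hm
  -- `q` inverts the orbit map on the left
  let q : M → H := fun m' => (e m).2⁻¹ * (e m').2
  have hq : ContMDiffAt J K ω q m :=
    contMDiffAt_const.mul (contMDiffAt_snd.comp m
      (he.holomorphic.contMDiffAt (e.open_source.mem_nhds hms)))
  refine Function.LeftInverse.injective (g := modelDeriv J K q m) fun z => ?_
  refine modelDeriv_comp_eq_id K J (f := fun h : H => op h • m) (by simp)
    (hq.mdifferentiableAt (by simp)) ((hp.contMDiff_orbit m).mdifferentiableAt (by simp))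
    (Filter.Eventually.of_forall fun h => ?_) z
  simp only [q]
  rw [he.equivariant m hms, inv_mul_cancel_left]

theorem surjective_proj (m : M) : Function.Surjective (modelDeriv J I p m) := by
  obtain ⟨e, he, hm⟩ := hp.exists_trivialization (p m)
  have hms : m ∈ e.source := e.mem_source.2 hm
  let s : X → M := fun x => e.toOpenPartialHomeomorph.symm (x, (e m).2)
  have hs : ContMDiffAt I J ω s (p m) :=
    (he.holomorphic_symm.contMDiffAt (e.open_target.mem_nhds (e.mem_target.2 hm))).comp (p m)
      (contMDiffAt_id.prodMk contMDiffAt_const)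
  have hsm : s (p m) = m := by
    simp only [s]
    rw [← e.coe_fst hms]
    exact e.left_inv hms
  refine Function.RightInverse.surjective (g := modelDeriv I J s (p m)) fun v => ?_
  refine modelDeriv_comp_eq_id I J hsm (hp.holomorphic_proj.mdifferentiableAt (by simp))
    (hs.mdifferentiableAt (by simp)) ?_ v
  filter_upwards [e.open_baseSet.mem_nhds hm] with x hx
  exact e.proj_symm_apply' hx

theorem finrank_eq [FiniteDimensional ℂ EX] [FiniteDimensional ℂ EH] (m : M) :
    Module.finrank ℂ EM = Module.finrank ℂ EX + Module.finrank ℂ EH := by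
  obtain ⟨e, he, hm⟩ := hp.exists_trivialization (p m)
  have hms : m ∈ e.source := e.mem_source.2 hm
  have hmt : e m ∈ e.target := e.map_source hms
  have h1 : MDifferentiableAt J (I.prod K) e m :=
    (he.holomorphic.contMDiffAt (e.open_source.mem_nhds hms)).mdifferentiableAt (by simp)
  have h2 : MDifferentiableAt (I.prod K) J e.toOpenPartialHomeomorph.symm (e m) :=
    (he.holomorphic_symm.contMDiffAt (e.open_target.mem_nhds hmt)).mdifferentiableAt (by simp)
  have hl := modelDeriv_comp_eq_id J (I.prod K) rfl h2 h1 (by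
    filter_upwards [e.open_source.mem_nhds hms] with z hz
    exact e.left_inv hz)
  have hr := modelDeriv_comp_eq_id (I.prod K) J (e.left_inv hms) h1 h2 (by
    filter_upwards [e.open_target.mem_nhds hmt] with z hz
    exact e.right_inv hz)
  rw [← Module.finrank_prod]
  exact LinearEquiv.finrank_eq (LinearEquiv.ofLinearMap
    (modelDeriv J (I.prod K) e m).toLinearMap
    (modelDeriv (I.prod K) J e.toOpenPartialHomeomorph.symm (e m)).toLinearMap
    (LinearMap.ext hr) (LinearMap.ext hl))

theorem proj_translateDeriv (h : H) (m : M) (v : EM) :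
    modelDeriv J I p (op h • m) (translateDeriv J h m v) = modelDeriv J I p m v := by
  have h1 := modelDeriv_comp J J I (x := m) (f := fun m : M => op h • m) (g := p) rfl
    (hp.holomorphic_proj.mdifferentiableAt (by simp))
    ((hp.contMDiff_translate h).mdifferentiableAt (by simp))
  have h2 : p ∘ (fun m : M => op h • m) = p := funext fun m => hp.proj_smul h m
  rw [h2] at h1
  exact congrArg (fun L => L v) h1.symm

/-- The fundamental vector fields transform under right translations by the adjoint
representation. -/
theorem translateDeriv_orbitDeriv_adjointMap [LieGroup K ω H] (h : H) (m : M) (z : EH) :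
    translateDeriv J h m (orbitDeriv J K H m (adjointMap K h z)) =
      orbitDeriv J K H (op h • m) z := by
  have hR : MDifferentiableAt J J (fun m : M => op h • m) m :=
    (hp.contMDiff_translate h).mdifferentiableAt (by simp)
  have hA : MDifferentiableAt K J (fun k : H => op k • m) 1 :=
    (hp.contMDiff_orbit m).mdifferentiableAt (by simp)
  have hc : MDifferentiableAt K K (fun g : H => h * g * h⁻¹) 1 :=
    (contMDiff_conj K h).mdifferentiableAt (by simp)
  have h1 := modelDeriv_comp K K J (x := (1 : H)) (y := 1) (f := fun g : H => h * g * h⁻¹)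
    (by simp) hA hc
  have h2 := modelDeriv_comp K J J (x := (1 : H)) (y := m) (by simp) hR
    (f := (fun k : H => op k • m) ∘ fun g : H => h * g * h⁻¹)
    (MDifferentiableAt.comp_of_eq (f := fun g : H => h * g * h⁻¹) 1 hA hc (by simp))
  have h3 : (fun m : M => op h • m) ∘ (fun k : H => op k • m) ∘ (fun g : H => h * g * h⁻¹) =
      fun g : H => op g • op h • m := by
    funext g
    simp [smul_smul, ← op_mul]
  rw [h3, h1] at h2
  exact congrArg (fun L => L z) h2.symm

end IsPrincipalBundle

end Geometry

/-! ### CY structures and the canonical bundle of the base -/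

section Characters

variable {EH : Type*} [NormedAddCommGroup EH] [NormedSpace ℂ EH]
  {HH : Type*} [TopologicalSpace HH] {K : ModelWithCorners ℂ EH HH}
  {H : Type*} [Group H] [TopologicalSpace H] [ChartedSpace HH H]

/-- The product of two holomorphic characters. -/
def mulCharacter (χ ψ : HolomorphicCharacter K H) : HolomorphicCharacter K H where
  toMonoidHom := χ.toMonoidHom * ψ.toMonoidHom
  contMDiff_toFun := χ.contMDiff_toFun.mul ψ.contMDiff_toFun

/-- The inverse of a holomorphic character. -/
def invCharacter (χ : HolomorphicCharacter K H) : HolomorphicCharacter K H where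
  toMonoidHom := χ.toMonoidHom⁻¹
  contMDiff_toFun := χ.contMDiff_toFun.inv

theorem mulCharacter_apply (χ ψ : HolomorphicCharacter K H) (h : H) :
    mulCharacter χ ψ h = χ h * ψ h := rfl

end Characters

section CYStructures

variable {EX : Type uE} [NormedAddCommGroup EX] [NormedSpace ℂ EX] [FiniteDimensional ℂ EX]
  {HX : Type uH} [TopologicalSpace HX] {I : ModelWithCorners ℂ EX HX}
  {X : Type uX} [TopologicalSpace X] [ChartedSpace HX X]
  {EM : Type*} [NormedAddCommGroup EM] [NormedSpace ℂ EM]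
  {HM : Type*} [TopologicalSpace HM] {J : ModelWithCorners ℂ EM HM}
  {M : Type uM} [TopologicalSpace M] [ChartedSpace HM M]
  {EH : Type*} [NormedAddCommGroup EH] [NormedSpace ℂ EH] [FiniteDimensional ℂ EH]
  {HH : Type*} [TopologicalSpace HH] {K : ModelWithCorners ℂ EH HH}
  {H : Type*} [Group H] [TopologicalSpace H] [ChartedSpace HH H] [LieGroup K ω H]
  [MulAction Hᵐᵒᵖ M] {p : M → X}

variable
  {σ : Fin (Module.finrank ℂ EM) ≃ Fin (Module.finrank ℂ EX) ⊕ Fin (Module.finrank ℂ EH)}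

/-- Pulling back a contraction along a right translation: the fundamental vector fields are
permuted by the adjoint representation, whence the determinant. -/
theorem translate_apply_sumElim (hp : IsPrincipalBundle I J K H p) (h : H) (m : M)
    {Ω : CanonicalModel EM} {β : CanonicalModel EX}
    (hΩ : IsContraction σ (modelDeriv J I p (op h • m)) (orbitDeriv J K H (op h • m)) Ω β)
    (u : Fin (Module.finrank ℂ EX) → EM) :
    ((detAdjoint K H h : ℂˣ) : ℂ) * (Ω.compContinuousLinearMap (translateDeriv J h m))
      (Sum.elim u (orbitDeriv J K H m ∘ Module.finBasis ℂ EH) ∘ σ) =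
      β (modelDeriv J I p m ∘ u) := by
  rw [coe_detAdjoint, ← form_apply_sumElim_comp (hp.surjective_proj m) (hp.injective_orbitDeriv m)
    (hp.proj_orbitDeriv m)]
  have h1 : modelDeriv J I p m ∘ u =
      modelDeriv J I p (op h • m) ∘ (translateDeriv J h m ∘ u) :=
    funext fun i => (hp.proj_translateDeriv h m (u i)).symm
  rw [h1, ← hΩ]
  change Ω (translateDeriv J h m ∘ _) = _
  congr 1
  funext i
  simp only [Function.comp_apply]
  rcases σ i with j | j
  · rfl
  · exact hp.translateDeriv_orbitDeriv_adjointMap h m _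

variable [IsManifold I ω X] [IsManifold J ω M]

/-- Every tangent vector extends to a local holomorphic vector field. -/
theorem exists_contMDiffAt_vectorField (m₀ : M) (v : TangentSpace J m₀) :
    ∃ V : ∀ m : M, TangentSpace J m, V m₀ = v ∧ ContMDiffAt J (J.prod 𝓘(ℂ, EM)) ω
      (fun m => (⟨m, V m⟩ : TotalSpace EM (TangentSpace J : M → Type _))) m₀ := by
  set e := trivializationAt EM (TangentSpace J : M → Type _) m₀
  have hm₀ : m₀ ∈ e.baseSet := FiberBundle.mem_baseSet_trivializationAt' m₀
  refine ⟨fun m => e.symm m (e ⟨m₀, v⟩).2, e.symm_proj_apply ⟨m₀, v⟩ hm₀, ?_⟩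
  have h1 : ContMDiffAt J (J.prod 𝓘(ℂ, EM)) ω
      (fun m : M => e.toOpenPartialHomeomorph.symm (m, (e ⟨m₀, v⟩).2)) m₀ :=
    ((e.contMDiffOn_symm (IB := J) (n := ω)).contMDiffAt
      (e.open_target.mem_nhds (e.mem_target.2 hm₀))).comp m₀
        (contMDiffAt_id.prodMk contMDiffAt_const)
  refine h1.congr_of_eventuallyEq ?_
  filter_upwards [e.open_baseSet.mem_nhds hm₀] with m hm
  exact e.mk_symm hm _

/-- Contracting a family of top forms on `M` with the fundamental vector fields neither creates nor
destroys holomorphy: both families have the same values on suitable local frames. -/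
theorem contMDiff_contraction_iff [FiniteDimensional ℂ EM] (hp : IsPrincipalBundle I J K H p)
    {Ω : ∀ m : M, CanonicalFiber J m} {β : ∀ m : M, CanonicalFiber I (p m)}
    (h : ∀ m, IsContraction σ (modelDeriv J I p m) (orbitDeriv J K H m) (Ω m) (β m)) :
    ContMDiff J (J.prod 𝓘(ℂ, CanonicalModel EM)) ω
      (fun m => (⟨m, Ω m⟩ : TotalSpace (CanonicalModel EM) (fun m : M => CanonicalFiber J m))) ↔
    ContMDiff J (I.prod 𝓘(ℂ, CanonicalModel EX)) ω
      (fun m => (⟨p m, β m⟩ : TotalSpace (CanonicalModel EX)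
        (fun x : X => CanonicalFiber I x))) := by
  refine forall_congr' fun m₀ => ?_
  obtain ⟨w, hw⟩ := exists_lift_finBasis (hp.surjective_proj m₀)
  choose W hW₀ hW using fun i => exists_contMDiffAt_vectorField (J := J) m₀ (w i)
  have hPW : ∀ i, ContMDiffAt J (I.prod 𝓘(ℂ, EX)) ω (fun m => (⟨p m, modelDeriv J I p m (W i m)⟩ :
      TotalSpace EX (TangentSpace I : X → Type _))) m₀ := fun i =>
    contMDiffAt_mfderiv_apply (fun _ : M => p) (fun m => m) (fun m => W i m)
      (hp.holomorphic_proj.comp contMDiff_snd).contMDiffAt (hW i)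
  have hPW₀ : (fun i => modelDeriv J I p m₀ (W i m₀)) = Module.finBasis ℂ EX := by
    funext i
    rw [hW₀]
    exact hw i
  let V : ∀ m : M, Fin (Module.finrank ℂ EM) → TangentSpace J m := fun m =>
    Sum.elim (fun i => W i m) (fun j => orbitDeriv J K H m (Module.finBasis ℂ EH j)) ∘ σ
  have hV : ∀ i, ContMDiffAt J (J.prod 𝓘(ℂ, EM)) ω
      (fun m => (⟨m, V m i⟩ : TotalSpace EM (TangentSpace J : M → Type _))) m₀ := by
    intro i
    simp only [V, Function.comp_apply]
    rcases σ i with j | j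
    · exact hW j
    · exact (hp.contMDiff_orbitDeriv _).contMDiffAt
  have hV₀ : LinearIndependent ℂ (V m₀) := by
    have hξ : LinearIndependent ℂ (orbitDeriv J K H m₀ ∘ Module.finBasis ℂ EH) :=
      (Module.finBasis ℂ EH).linearIndependent.map' (orbitDeriv J K H m₀).toLinearMap
        (LinearMap.ker_eq_bot.2 (hp.injective_orbitDeriv m₀))
    exact (linearIndependent_sumElim_of_lift (Module.finBasis ℂ EX).linearIndependent
      (modelDeriv J I p m₀).toLinearMap hξ (fun j => hp.proj_orbitDeriv m₀ _)
      (w := fun i => W i m₀) (fun i => congrFun hPW₀ i)).comp σ σ.injective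
  have hΩβ : (fun m => Ω m (V m)) = fun m => β m (fun i => modelDeriv J I p m (W i m)) :=
    funext fun m => h m (fun i => W i m)
  constructor
  · intro hΩ
    refine contMDiffAt_form_of_apply hp.holomorphic_proj.contMDiffAt hPW ?_ ?_
    · rw [hPW₀]; exact (Module.finBasis ℂ EX).linearIndependent
    · rw [← hΩβ]
      exact contMDiffAt_form_apply hΩ hV
  · intro hβ
    refine contMDiffAt_form_of_apply contMDiffAt_id hV hV₀ ?_
    rw [hΩβ]
    exact contMDiffAt_form_apply hβ hPW

/-- The contraction of a CY structure with the fundamental vector fields is an equivariant section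
of the pullback of the canonical bundle. -/
theorem IsCYStructure.isEquivariantSection [FiniteDimensional ℂ EM]
    (hp : IsPrincipalBundle I J K H p) {Ω : ∀ m : M, CanonicalFiber J m}
    {χ : HolomorphicCharacter K H} (hΩ : IsCYStructure J K Ω χ)
    {β : ∀ (m : M) (x : X), p m = x → CanonicalFiber I x}
    (hβ : ∀ m, IsContraction σ (modelDeriv J I p m) (orbitDeriv J K H m) (Ω m) (β m (p m) rfl)) :
    IsEquivariantSection (CanonicalModel EX) hp (mulCharacter (detAdjoint K H) χ) β where
  holomorphic := (contMDiff_contraction_iff hp hβ).1 hΩ.holomorphic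
  nowhere_zero := by
    rintro m _ rfl
    exact ((hβ m).ne_zero_iff (hp.surjective_proj m) (hp.injective_orbitDeriv m)
      (hp.proj_orbitDeriv m)).1 (hΩ.nowhere_zero m)
  equivariant := by
    rintro m _ rfl h
    have hx := hp.proj_smul h m
    have hβh : IsContraction σ (modelDeriv J I p (op h • m)) (orbitDeriv J K H (op h • m))
        (Ω (op h • m)) (β (op h • m) (p m) hx) := by
      have : ∀ (x : X) (hx : p (op h • m) = x), IsContraction σ (modelDeriv J I p (op h • m))
          (orbitDeriv J K H (op h • m)) (Ω (op h • m)) (β (op h • m) x hx) := by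
        rintro _ rfl; exact hβ _
      exact this _ _
    have key : ∀ t : Fin (Module.finrank ℂ EX) → EX, β (op h • m) (p m) hx t =
        ((mulCharacter (detAdjoint K H) χ h : ℂˣ) : ℂ) * β m (p m) rfl t := by
      intro t
      obtain ⟨u, rfl⟩ := exists_comp_eq (hp.surjective_proj m) t
      refine (translate_apply_sumElim hp h m hβh u).symm.trans ?_
      rw [mulCharacter_apply, Units.val_mul, mul_assoc]
      refine congrArg _ ?_
      refine Eq.trans ?_ (congrArg _ (hβ m u))
      exact congrArg (fun f : CanonicalModel EM => f _) (hΩ.equivariant h m)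
    exact ContinuousAlternatingMap.ext key

/-- A family of top forms on `M` whose contraction is an equivariant section of the pullback of the
canonical bundle is a CY structure. -/
theorem IsEquivariantSection.isCYStructure [FiniteDimensional ℂ EM]
    {hp : IsPrincipalBundle I J K H p} {Ω : ∀ m : M, CanonicalFiber J m}
    {ψ : HolomorphicCharacter K H} {β : ∀ (m : M) (x : X), p m = x → CanonicalFiber I x}
    (hβ : IsEquivariantSection (CanonicalModel EX) hp ψ β)
    (hΩ : ∀ m, IsContraction σ (modelDeriv J I p m) (orbitDeriv J K H m) (Ω m) (β m (p m) rfl)) :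
    IsCYStructure J K Ω (mulCharacter ψ (invCharacter (detAdjoint K H))) where
  holomorphic := (contMDiff_contraction_iff hp hΩ).2 hβ.holomorphic
  nowhere_zero m := ((hΩ m).ne_zero_iff (hp.surjective_proj m) (hp.injective_orbitDeriv m)
      (hp.proj_orbitDeriv m)).2 (hβ.nowhere_zero m _ rfl)
  equivariant := by
    intro h m
    have hx := hp.proj_smul h m
    have hΩh : IsContraction σ (modelDeriv J I p (op h • m)) (orbitDeriv J K H (op h • m))
        (Ω (op h • m)) (β (op h • m) (p m) hx) := by
      have : ∀ (x : X) (hx : p (op h • m) = x), IsContraction σ (modelDeriv J I p (op h • m))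
          (orbitDeriv J K H (op h • m)) (Ω (op h • m)) (β (op h • m) x hx) := by
        rintro _ rfl; exact hΩ _
      exact this _ _
    refine IsContraction.left_unique (hp.surjective_proj m) (hp.injective_orbitDeriv m)
      (hp.proj_orbitDeriv m) (Ω := translateForm J h Ω m) (fun u => ?_)
      ((hΩ m).smul ((mulCharacter ψ (invCharacter (detAdjoint K H)) h : ℂˣ) : ℂ))
    have h1 := translate_apply_sumElim hp h m hΩh u
    have h2 : β (op h • m) (p m) hx = ((ψ h : ℂˣ) : ℂ) • β m (p m) rfl :=
      hβ.equivariant m (p m) rfl h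
    have h3 : (β (op h • m) (p m) hx : CanonicalModel EX) (modelDeriv J I p m ∘ u) =
        ((ψ h : ℂˣ) : ℂ) * (β m (p m) rfl : CanonicalModel EX) (modelDeriv J I p m ∘ u) :=
      congrArg (fun f : CanonicalModel EX => f (modelDeriv J I p m ∘ u)) h2
    have h4 := h1.trans h3
    apply mul_left_cancel₀ (Units.ne_zero (detAdjoint K H h))
    have aux : ∀ (a b : ℂˣ) (t : ℂ), (b : ℂ) * t = a * (((b * a⁻¹ : ℂˣ) : ℂ) * t) := by
      intro a b t
      rw [← mul_assoc, ← Units.val_mul, mul_comm b, mul_inv_cancel_left]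
    exact h4.trans (aux _ _ _)

/-- A principal bundle admits a CY structure if and only if the canonical bundle of the base is
associated to it by a holomorphic character. -/
theorem admitsCYStructure_iff [FiniteDimensional ℂ EM] (hp : IsPrincipalBundle I J K H p) :
    AdmitsCYStructure J M K H ↔
      ∃ χ : HolomorphicCharacter K H, CanonicalIso I (associatedLineBundle hp χ) := by
  rcases isEmpty_or_nonempty M with hM | ⟨⟨m₀⟩⟩
  · refine ⟨fun _ => ⟨1, ?_⟩, fun _ => ⟨fun m => isEmptyElim m, 1, ?_⟩⟩
    · have : IsEquivariantSection (CanonicalModel EX) hp 1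
          (fun (m : M) (x : X) _ => (isEmptyElim m : CanonicalFiber I x)) :=
        ⟨fun m => isEmptyElim m, fun m => isEmptyElim m, fun m => isEmptyElim m⟩
      exact this.holomorphicallyIsomorphic canonicalModelEval_injective
    · exact ⟨fun m => isEmptyElim m, fun m => isEmptyElim m, fun _ m => isEmptyElim m⟩
  -- A point of `M` is needed to compare the dimensions of `M`, `X` and `H`.
  · let σ : Fin (Module.finrank ℂ EM) ≃ Fin (Module.finrank ℂ EX) ⊕ Fin (Module.finrank ℂ EH) :=
      (finCongr (hp.finrank_eq m₀)).trans finSumFinEquiv.symm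
    constructor
    · rintro ⟨Ω, χ, hΩ⟩
      choose β hβ using fun m => exists_contraction (σ := σ) (hp.surjective_proj m)
        (hp.injective_orbitDeriv m) (hp.proj_orbitDeriv m) (Ω m)
      exact ⟨_, (hΩ.isEquivariantSection hp (σ := σ) (β := fun m x _ => (β m : CanonicalModel EX))
        hβ).holomorphicallyIsomorphic canonicalModelEval_injective⟩
    · rintro ⟨χ, hχ⟩
      obtain ⟨β, hβ⟩ := exists_isEquivariantSection hχ
      choose Ω hΩ using fun m => exists_form_of_contraction (σ := σ) (hp.surjective_proj m)
        (hp.injective_orbitDeriv m) (hp.proj_orbitDeriv m) (β m (p m) rfl)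
      exact ⟨Ω, _, hβ.isCYStructure (σ := σ) hΩ⟩

end CYStructures

/-! ### Characters of the multiplicative group and the bundle of nonzero vectors -/

section Units

variable {EY : Type*} [NormedAddCommGroup EY] [NormedSpace ℂ EY]
  {HY : Type*} [TopologicalSpace HY] {IY : ModelWithCorners ℂ EY HY}
  {Y : Type*} [TopologicalSpace Y] [ChartedSpace HY Y]

theorem contMDiffAt_units_of_val {u : Y → ℂˣ} {y₀ : Y}
    (h : ContMDiffAt IY 𝓘(ℂ) ω (fun y => (u y : ℂ)) y₀) : ContMDiffAt IY 𝓘(ℂ) ω u y₀ := by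
  have hs : ContMDiffOn 𝓘(ℂ) 𝓘(ℂ) ω
      (Units.isOpenEmbedding_val.toOpenPartialHomeomorph (Units.val : ℂˣ → ℂ)).symm
      (range (Units.val : ℂˣ → ℂ)) := contMDiffOn_isOpenEmbedding_symm Units.isOpenEmbedding_val
  have h1 := (hs.contMDiffAt (Units.isOpenEmbedding_val.isOpen_range.mem_nhds
    (mem_range_self (u y₀)))).comp y₀ h
  refine h1.congr_of_eventuallyEq (Filter.Eventually.of_forall fun y => ?_)
  exact (Units.isOpenEmbedding_val.toOpenPartialHomeomorph_left_inv).symm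

theorem contMDiffAt_zpow_of_ne_zero {f : Y → ℂ} {y₀ : Y} (hf : ContMDiffAt IY 𝓘(ℂ) ω f y₀)
    (h0 : f y₀ ≠ 0) (l : ℤ) : ContMDiffAt IY 𝓘(ℂ) ω (fun y => f y ^ l) y₀ :=
  ((analyticAt_id.fun_zpow h0).contDiffAt : ContDiffAt ℂ ω (fun z : ℂ => z ^ l) (f y₀)).contMDiffAt
    |>.comp y₀ hf

/-- The character `c ↦ c ^ l` of `ℂ^×`. -/
def zpowCharacter (l : ℤ) : HolomorphicCharacter 𝓘(ℂ) ℂˣ where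
  toMonoidHom := zpowGroupHom l
  contMDiff_toFun := fun c => contMDiffAt_units_of_val (by
    change ContMDiffAt 𝓘(ℂ) 𝓘(ℂ) ω (fun c : ℂˣ => ((c ^ l : ℂˣ) : ℂ)) c
    simp only [Units.val_zpow_eq_zpow_val]
    exact contMDiffAt_zpow_of_ne_zero Units.contMDiff_val.contMDiffAt c.ne_zero l)

theorem zpowCharacter_apply (l : ℤ) (c : ℂˣ) : zpowCharacter l c = c ^ l := rfl

/-- A holomorphic homomorphism from the additive group `ℂ` to `ℂ^×` is `z ↦ exp (a z)`. -/
theorem exists_eq_exp_of_map_add {f : ℂ → ℂ} (hf : Differentiable ℂ f) (h0 : f 0 = 1)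
    (hadd : ∀ z w, f (z + w) = f z * f w) : ∃ a : ℂ, ∀ z, f z = Complex.exp (a * z) := by
  refine ⟨deriv f 0, fun z => ?_⟩
  have hderiv : ∀ z, HasDerivAt f (f z * deriv f 0) z := by
    intro z
    have h1 : HasDerivAt (fun w => f z * f (w - z)) (f z * deriv f 0) z := by
      have h2 : HasDerivAt f (deriv f 0) (z - z) := by
        rw [sub_self]; exact (hf 0).hasDerivAt
      simpa using (h2.comp_sub_const z z).const_mul (f z)
    have h3 : (fun w => f z * f (w - z)) = f := funext fun w => by rw [← hadd, add_sub_cancel]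
    rwa [h3] at h1
  have hg : ∀ z, HasDerivAt (fun z => f z * Complex.exp (-(deriv f 0 * z))) 0 z := by
    intro z
    have h1 : HasDerivAt (fun z => Complex.exp (-(deriv f 0 * z)))
        (Complex.exp (-(deriv f 0 * z)) * (-(deriv f 0 * 1))) z :=
      (((hasDerivAt_id z).const_mul (deriv f 0)).neg).cexp
    exact ((hderiv z).mul h1).congr_deriv (by ring)
  have hconst := is_const_of_deriv_eq_zero (fun z => (hg z).differentiableAt)
    (fun z => (hg z).deriv) z 0
  simp only [h0, mul_zero, neg_zero, Complex.exp_zero, mul_one] at hconst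
  rw [Complex.exp_neg] at hconst
  rwa [mul_inv_eq_one₀ (Complex.exp_ne_zero _)] at hconst

/-- The holomorphic characters of `ℂ^×` are the integer powers. -/
theorem exists_eq_zpowCharacter (χ : HolomorphicCharacter 𝓘(ℂ) ℂˣ) :
    ∃ l : ℤ, χ = zpowCharacter l := by
  -- `χ ∘ exp` is `z ↦ exp (a z)`, and it takes the value `1` at `2πi`, so `a` is an integer.
  let E : ℂ → ℂˣ := fun z => Units.mk0 (Complex.exp z) (Complex.exp_ne_zero z)
  have hE : ContMDiff 𝓘(ℂ) 𝓘(ℂ) ω E := fun z => contMDiffAt_units_of_val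
    (Complex.contDiff_exp.contMDiff.contMDiffAt)
  have hEadd : ∀ z w, E (z + w) = E z * E w := fun z w => Units.ext (Complex.exp_add z w)
  have hE0 : E 0 = 1 := Units.ext Complex.exp_zero
  have hf : Differentiable ℂ (fun z => ((χ (E z) : ℂˣ) : ℂ)) :=
    ((Units.contMDiff_val.comp (χ.contMDiff_toFun.comp hE)).contDiff (n := ω)).differentiable
      (by simp)
  obtain ⟨a, ha⟩ := exists_eq_exp_of_map_add hf (by rw [hE0, map_one, Units.val_one])
    (fun z w => by rw [hEadd, map_mul, Units.val_mul])
  have h2pi : E (2 * Real.pi * Complex.I) = 1 := Units.ext Complex.exp_two_pi_mul_I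
  have h1 := ha (2 * Real.pi * Complex.I)
  rw [h2pi, map_one, Units.val_one] at h1
  obtain ⟨l, hl⟩ := Complex.exp_eq_one_iff.1 h1.symm
  have hal : a = l := mul_right_cancel₀ Complex.two_pi_I_ne_zero hl
  refine ⟨l, DFunLike.ext _ _ fun c => Units.ext ?_⟩
  have hc : E (Complex.log c) = c := Units.ext (Complex.exp_log c.ne_zero)
  rw [zpowCharacter_apply, Units.val_zpow_eq_zpow_val]
  conv_lhs => rw [← hc]
  rw [ha, hal, Complex.exp_int_mul, Complex.exp_log c.ne_zero]

end Units

namespace HolomorphicLineBundle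

variable {E : Type uE} [NormedAddCommGroup E] [NormedSpace ℂ E]
  {HX : Type uH} [TopologicalSpace HX] {I : ModelWithCorners ℂ E HX}
  {X : Type uX} [TopologicalSpace X] [ChartedSpace HX X]
  (L : HolomorphicLineBundle.{uE, uH, uX, v} I X)
  {EY : Type*} [NormedAddCommGroup EY] [NormedSpace ℂ EY]
  {HY : Type*} [TopologicalSpace HY] {IY : ModelWithCorners ℂ EY HY}
  {Y : Type*} [TopologicalSpace Y] [ChartedSpace HY Y]

variable {L} in
theorem contMDiffAt_punctured_iff {f : Y → L.Punctured} {y₀ : Y} :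
    ContMDiffAt IY (I.prod 𝓘(ℂ)) ω f y₀ ↔
      ContMDiffAt IY (I.prod 𝓘(ℂ)) ω (fun y => (f y).1) y₀ :=
  (ChartedSpace.liftPropWithinAt_subtypeVal_comp_iff ..).symm

theorem contMDiff_puncturedProj : ContMDiff (I.prod 𝓘(ℂ)) I ω L.puncturedProj :=
  (contMDiff_proj L.Fiber).comp contMDiff_subtype_val

/-- The fibre coordinate on `L` in the trivialization around `x₀`. -/
def fiberCoord (x₀ : X) (q : TotalSpace ℂ L.Fiber) : ℂ := (trivializationAt ℂ L.Fiber x₀ q).2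

theorem fiberCoord_smul {x₀ x : X} (hx : x ∈ (trivializationAt ℂ L.Fiber x₀).baseSet) (c : ℂ)
    (v : L.Fiber x) : L.fiberCoord x₀ ⟨x, c • v⟩ = c * L.fiberCoord x₀ ⟨x, v⟩ :=
  ((trivializationAt ℂ L.Fiber x₀).linearEquivAt ℂ x hx).map_smul c v

theorem fiberCoord_ne_zero {x₀ : X} (P : L.Punctured)
    (hP : L.puncturedProj P ∈ (trivializationAt ℂ L.Fiber x₀).baseSet) :
    L.fiberCoord x₀ P.1 ≠ 0 := fun h =>
  P.2 (((trivializationAt ℂ L.Fiber x₀).linearEquivAt ℂ P.1.1 hP).map_eq_zero_iff.1 h)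

theorem contMDiffAt_fiberCoord (x₀ : X) (q : TotalSpace ℂ L.Fiber)
    (hq : q.1 ∈ (trivializationAt ℂ L.Fiber x₀).baseSet) :
    ContMDiffAt (I.prod 𝓘(ℂ)) 𝓘(ℂ) ω (L.fiberCoord x₀) q := by
  have h1 := ((trivializationAt ℂ L.Fiber x₀).contMDiffOn (IB := I) (n := ω)).contMDiffAt
    ((trivializationAt ℂ L.Fiber x₀).open_source.mem_nhds
      ((trivializationAt ℂ L.Fiber x₀).mem_source.2 hq))
  exact contMDiffAt_snd.comp q h1

theorem contMDiff_punctured_smul :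
    ContMDiff ((I.prod 𝓘(ℂ)).prod 𝓘(ℂ)) (I.prod 𝓘(ℂ)) ω
      (fun q : L.Punctured × ℂˣ => op q.2 • q.1) := by
  intro q₀
  rw [contMDiffAt_punctured_iff, contMDiffAt_totalSpace]
  have hproj : ContMDiffAt ((I.prod 𝓘(ℂ)).prod 𝓘(ℂ)) I ω
      (fun q : L.Punctured × ℂˣ => L.puncturedProj q.1) q₀ :=
    (L.contMDiff_puncturedProj.comp contMDiff_fst).contMDiffAt
  refine ⟨hproj, ?_⟩
  have hmem : L.puncturedProj q₀.1 ∈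
      (trivializationAt ℂ L.Fiber (L.puncturedProj q₀.1)).baseSet :=
    FiberBundle.mem_baseSet_trivializationAt' _
  have h1 : ContMDiffAt ((I.prod 𝓘(ℂ)).prod 𝓘(ℂ)) 𝓘(ℂ) ω
      (fun q : L.Punctured × ℂˣ => L.fiberCoord (L.puncturedProj q₀.1) q.1.1) q₀ :=
    ContMDiffAt.comp q₀ (f := fun q : L.Punctured × ℂˣ => q.1.1)
      (L.contMDiffAt_fiberCoord _ q₀.1.1 hmem)
      (contMDiff_subtype_val.comp contMDiff_fst).contMDiffAt
  have h2 : ContMDiffAt ((I.prod 𝓘(ℂ)).prod 𝓘(ℂ)) 𝓘(ℂ) ω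
      (fun q : L.Punctured × ℂˣ => (q.2 : ℂ)) q₀ :=
    (Units.contMDiff_val.comp contMDiff_snd).contMDiffAt
  refine (h2.mul h1).congr_of_eventuallyEq ?_
  filter_upwards [hproj.continuousAt ((trivializationAt ℂ L.Fiber _).open_baseSet.mem_nhds hmem)]
    with q hq
  exact L.fiberCoord_smul hq _ _

/-- The fibre coordinate of a point of `L^×` as a unit; the value `1` is used where the coordinate
is not defined. -/
def unitCoord (x₀ : X) (P : L.Punctured) : ℂˣ :=
  open Classical in if h : L.fiberCoord x₀ P.1 ≠ 0 then Units.mk0 _ h else 1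

theorem coe_unitCoord {x₀ : X} {P : L.Punctured}
    (hP : L.puncturedProj P ∈ (trivializationAt ℂ L.Fiber x₀).baseSet) :
    (L.unitCoord x₀ P : ℂ) = L.fiberCoord x₀ P.1 := by
  rw [unitCoord, dif_pos (L.fiberCoord_ne_zero P hP), Units.val_mk0]

/-- The point of `L^×` over `x` with fibre coordinate `c` in the trivialization around `x₀`; over
points outside the domain of the trivialization, the point over `x₀` is used instead. -/
def pointOfCoord (x₀ : X) (a : X × ℂˣ) : L.Punctured :=
  open Classical in
  if hx : a.1 ∈ (trivializationAt ℂ L.Fiber x₀).baseSet then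
    ⟨⟨a.1, ((trivializationAt ℂ L.Fiber x₀).linearEquivAt ℂ a.1 hx).symm (a.2 : ℂ)⟩,
      ((LinearEquiv.map_ne_zero_iff _).2 a.2.ne_zero)⟩
  else
    ⟨⟨x₀, ((trivializationAt ℂ L.Fiber x₀).linearEquivAt ℂ x₀
      (FiberBundle.mem_baseSet_trivializationAt' x₀)).symm (a.2 : ℂ)⟩,
      ((LinearEquiv.map_ne_zero_iff _).2 a.2.ne_zero)⟩

theorem pointOfCoord_val {x₀ : X} {a : X × ℂˣ}
    (ha : a.1 ∈ (trivializationAt ℂ L.Fiber x₀).baseSet) :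
    (L.pointOfCoord x₀ a).1 =
      (trivializationAt ℂ L.Fiber x₀).toOpenPartialHomeomorph.symm (a.1, (a.2 : ℂ)) := by
  rw [pointOfCoord, dif_pos ha]
  exact (trivializationAt ℂ L.Fiber x₀).mk_symm ha _

theorem puncturedProj_pointOfCoord {x₀ : X} {a : X × ℂˣ}
    (ha : a.1 ∈ (trivializationAt ℂ L.Fiber x₀).baseSet) :
    L.puncturedProj (L.pointOfCoord x₀ a) = a.1 := by
  rw [pointOfCoord, dif_pos ha]; rfl

theorem unitCoord_pointOfCoord {x₀ : X} {a : X × ℂˣ}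
    (ha : a.1 ∈ (trivializationAt ℂ L.Fiber x₀).baseSet) :
    L.unitCoord x₀ (L.pointOfCoord x₀ a) = a.2 := by
  apply Units.ext
  rw [L.coe_unitCoord (by rwa [L.puncturedProj_pointOfCoord ha]), fiberCoord,
    L.pointOfCoord_val ha, (trivializationAt ℂ L.Fiber x₀).apply_symm_apply' ha]

theorem pointOfCoord_unitCoord {x₀ : X} {P : L.Punctured}
    (hP : L.puncturedProj P ∈ (trivializationAt ℂ L.Fiber x₀).baseSet) :
    L.pointOfCoord x₀ (L.puncturedProj P, L.unitCoord x₀ P) = P := by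
  apply Subtype.ext
  rw [L.pointOfCoord_val hP, L.coe_unitCoord hP]
  exact (trivializationAt ℂ L.Fiber x₀).symm_apply_mk_proj
    ((trivializationAt ℂ L.Fiber x₀).mem_source.2 hP)

theorem contMDiffOn_prodMk_unitCoord (x₀ : X) :
    ContMDiffOn (I.prod 𝓘(ℂ)) (I.prod 𝓘(ℂ)) ω
      (fun P : L.Punctured => (L.puncturedProj P, L.unitCoord x₀ P))
      (L.puncturedProj ⁻¹' (trivializationAt ℂ L.Fiber x₀).baseSet) := by
  intro P hP
  refine (L.contMDiff_puncturedProj.contMDiffAt.prodMk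
    (contMDiffAt_units_of_val ?_)).contMDiffWithinAt
  refine ((L.contMDiffAt_fiberCoord x₀ P.1 hP).comp P
    contMDiff_subtype_val.contMDiffAt).congr_of_eventuallyEq ?_
  filter_upwards [L.contMDiff_puncturedProj.continuous.continuousAt
    ((trivializationAt ℂ L.Fiber x₀).open_baseSet.mem_nhds hP)] with Q hQ
  exact L.coe_unitCoord hQ

theorem contMDiffOn_pointOfCoord (x₀ : X) :
    ContMDiffOn (I.prod 𝓘(ℂ)) (I.prod 𝓘(ℂ)) ω (L.pointOfCoord x₀)
      ((trivializationAt ℂ L.Fiber x₀).baseSet ×ˢ univ) := by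
  intro a ha
  refine ContMDiffAt.contMDiffWithinAt (contMDiffAt_punctured_iff.2 ?_)
  have h1 : ContMDiffAt (I.prod 𝓘(ℂ)) (I.prod 𝓘(ℂ)) ω
      (fun a : X × ℂˣ => (a.1, (a.2 : ℂ))) a :=
    contMDiffAt_fst.prodMk (Units.contMDiff_val.comp contMDiff_snd).contMDiffAt
  have h2 := ((trivializationAt ℂ L.Fiber x₀).contMDiffOn_symm (IB := I) (n := ω)).contMDiffAt
    ((trivializationAt ℂ L.Fiber x₀).open_target.mem_nhds
      ((trivializationAt ℂ L.Fiber x₀).mem_target.2 ha.1 : (a.1, (a.2 : ℂ)) ∈ _))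
  refine (h2.comp a h1).congr_of_eventuallyEq ?_
  filter_upwards [((trivializationAt ℂ L.Fiber x₀).open_baseSet.prod isOpen_univ).mem_nhds ha]
    with b hb
  exact L.pointOfCoord_val hb.1

/-- The local trivialization of `L^×` as a principal `ℂ^×`-bundle which is induced by the
trivialization of `L` around `x₀`. -/
def puncturedTrivialization (x₀ : X) : Trivialization ℂˣ L.puncturedProj where
  toFun P := (L.puncturedProj P, L.unitCoord x₀ P)
  invFun := L.pointOfCoord x₀
  source := L.puncturedProj ⁻¹' (trivializationAt ℂ L.Fiber x₀).baseSet
  target := (trivializationAt ℂ L.Fiber x₀).baseSet ×ˢ univ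
  map_source' _ hP := ⟨hP, mem_univ _⟩
  map_target' a ha := by
    rw [mem_preimage, L.puncturedProj_pointOfCoord ha.1]
    exact ha.1
  left_inv' _ hP := L.pointOfCoord_unitCoord hP
  right_inv' a ha :=
    Prod.ext (L.puncturedProj_pointOfCoord ha.1) (L.unitCoord_pointOfCoord ha.1)
  open_source := (trivializationAt ℂ L.Fiber x₀).open_baseSet.preimage
    L.contMDiff_puncturedProj.continuous
  open_target := (trivializationAt ℂ L.Fiber x₀).open_baseSet.prod isOpen_univ
  continuousOn_toFun := (L.contMDiffOn_prodMk_unitCoord x₀).continuousOn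
  continuousOn_invFun := (L.contMDiffOn_pointOfCoord x₀).continuousOn
  baseSet := (trivializationAt ℂ L.Fiber x₀).baseSet
  open_baseSet := (trivializationAt ℂ L.Fiber x₀).open_baseSet
  source_eq := rfl
  target_eq := rfl
  proj_toFun _ _ := rfl

/-- `L^×` is a principal `ℂ^×`-bundle. -/
theorem isPrincipalBundle_punctured :
    IsPrincipalBundle I (I.prod 𝓘(ℂ)) 𝓘(ℂ) ℂˣ L.puncturedProj where
  holomorphic_proj := L.contMDiff_puncturedProj
  holomorphic_action := L.contMDiff_punctured_smul
  proj_smul _ _ := rfl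
  exists_trivialization x := by
    refine ⟨L.puncturedTrivialization x,
      ⟨fun P hP c => ?_, L.contMDiffOn_prodMk_unitCoord x, L.contMDiffOn_pointOfCoord x⟩,
      FiberBundle.mem_baseSet_trivializationAt' x⟩
    have hP' : L.puncturedProj P ∈ (trivializationAt ℂ L.Fiber x).baseSet := hP
    apply Units.ext
    rw [Units.val_mul, mul_comm]
    change (L.unitCoord x (op c • P) : ℂ) = c * (L.unitCoord x P : ℂ)
    rw [L.coe_unitCoord hP', L.coe_unitCoord (P := op c • P) hP']
    exact L.fiberCoord_smul hP' _ _

/-- The `l`-th power `P^{⊗ l} ∈ (L^{⊗ l})_x` of a point `P ∈ L^×` over `x`. The fibre of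
`L^{⊗ l}` over `x` is `ℂ`, via the chosen trivialization of `L` around `x`. -/
def power (l : ℤ) (P : L.Punctured) (x : X) : (L.zpow l).Fiber x :=
  (L.fiberCoord x P.1 ^ l : ℂ)

/-- The coordinate of `P^{⊗ l}` in any trivialization is the `l`-th power of that of `P`, since the
transition functions of `L^{⊗ l}` are the `l`-th powers of those of `L`. -/
theorem trivializationAt_power (l : ℤ) (x₀ : X) (P : L.Punctured)
    (hP : L.puncturedProj P ∈ (trivializationAt ℂ L.Fiber x₀).baseSet) :
    (trivializationAt ℂ (L.zpow l).Fiber x₀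
      ⟨L.puncturedProj P, L.power l P (L.puncturedProj P)⟩).2 = L.fiberCoord x₀ P.1 ^ l := by
  let i : X → trivializationAtlas ℂ L.Fiber := fun x =>
    ⟨trivializationAt ℂ L.Fiber x, trivialization_mem_atlas ℂ L.Fiber x⟩
  have hP' : L.puncturedProj P ∈
      (trivializationAt ℂ L.Fiber (L.puncturedProj P)).baseSet :=
    FiberBundle.mem_baseSet_trivializationAt' _
  have h1 : L.transition (i (L.puncturedProj P)) (i x₀) (L.puncturedProj P) *
      L.fiberCoord (L.puncturedProj P) P.1 = L.fiberCoord x₀ P.1 := by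
    rw [← L.transition_mul]
    change (trivializationAt ℂ L.Fiber (L.puncturedProj P)).coordChangeL ℂ
      (trivializationAt ℂ L.Fiber x₀) (L.puncturedProj P)
        (trivializationAt ℂ L.Fiber (L.puncturedProj P) P.1).2 = _
    rw [Trivialization.coordChangeL_apply _ _ ⟨hP', hP⟩]
    have h2 := (trivializationAt ℂ L.Fiber (L.puncturedProj P)).symm_proj_apply P.1 hP'
    rw [show (trivializationAt ℂ L.Fiber (L.puncturedProj P)).symm (L.puncturedProj P)
      (trivializationAt ℂ L.Fiber (L.puncturedProj P) P.1).2 = P.1.2 from h2]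
    rfl
  rw [← h1, mul_zpow]
  rfl

theorem contMDiff_power (l : ℤ) :
    ContMDiff (I.prod 𝓘(ℂ)) (I.prod 𝓘(ℂ)) ω (fun P : L.Punctured =>
      (⟨L.puncturedProj P, L.power l P (L.puncturedProj P)⟩ :
        TotalSpace ℂ (L.zpow l).Fiber)) := by
  intro P₀
  rw [contMDiffAt_totalSpace]
  refine ⟨L.contMDiff_puncturedProj.contMDiffAt, ?_⟩
  have hmem : L.puncturedProj P₀ ∈ (trivializationAt ℂ L.Fiber (L.puncturedProj P₀)).baseSet :=
    FiberBundle.mem_baseSet_trivializationAt' _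
  have h1 : ContMDiffAt (I.prod 𝓘(ℂ)) 𝓘(ℂ) ω
      (fun P : L.Punctured => L.fiberCoord (L.puncturedProj P₀) P.1) P₀ :=
    (L.contMDiffAt_fiberCoord _ P₀.1 hmem).comp P₀ contMDiff_subtype_val.contMDiffAt
  refine (contMDiffAt_zpow_of_ne_zero h1 (L.fiberCoord_ne_zero P₀ hmem) l).congr_of_eventuallyEq ?_
  filter_upwards [L.contMDiff_puncturedProj.continuous.continuousAt
    ((trivializationAt ℂ L.Fiber _).open_baseSet.mem_nhds hmem)] with P hP
  exact L.trivializationAt_power l _ P hP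

end HolomorphicLineBundle

/-! ### Principal bundles for the multiplicative group -/

section EquivariantMaps

variable {EX : Type*} [NormedAddCommGroup EX] [NormedSpace ℂ EX]
  {HX : Type*} [TopologicalSpace HX] {I : ModelWithCorners ℂ EX HX}
  {X : Type*} [TopologicalSpace X] [ChartedSpace HX X]
  {EM : Type*} [NormedAddCommGroup EM] [NormedSpace ℂ EM]
  {HM : Type*} [TopologicalSpace HM] {J : ModelWithCorners ℂ EM HM}
  {M : Type*} [TopologicalSpace M] [ChartedSpace HM M]
  {EM' : Type*} [NormedAddCommGroup EM'] [NormedSpace ℂ EM']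
  {HM' : Type*} [TopologicalSpace HM'] {J' : ModelWithCorners ℂ EM' HM'}
  {M' : Type*} [TopologicalSpace M'] [ChartedSpace HM' M']
  {EH : Type*} [NormedAddCommGroup EH] [NormedSpace ℂ EH]
  {HH : Type*} [TopologicalSpace HH] {K : ModelWithCorners ℂ EH HH}
  {H : Type*} [Group H] [TopologicalSpace H] [ChartedSpace HH H] [LieGroup K ω H]
  [MulAction Hᵐᵒᵖ M] [MulAction Hᵐᵒᵖ M'] {p : M → X} {p' : M' → X}

/-- A holomorphic equivariant map between principal bundles has a holomorphic inverse near each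
fibre: in local trivializations it is `(x, g) ↦ (x, k(x) g)` for a holomorphic function `k`. -/
theorem exists_local_inverse (hp : IsPrincipalBundle I J K H p)
    (hp' : IsPrincipalBundle I J' K H p') {q : M → M'} (hq : ContMDiff J J' ω q)
    (hqp : ∀ m, p' (q m) = p m) (hqs : ∀ (h : H) (m : M), q (op h • m) = op h • q m) (x₀ : X) :
    ∃ (U : Set X) (r : M' → M), IsOpen U ∧ x₀ ∈ U ∧ ContMDiffOn J' J ω r (p' ⁻¹' U) ∧
      (∀ m, p m ∈ U → r (q m) = m) ∧ ∀ m', p' m' ∈ U → q (r m') = m' := by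
  obtain ⟨e, he, hxe⟩ := hp.exists_trivialization x₀
  obtain ⟨e', he', hxe'⟩ := hp'.exists_trivialization x₀
  let s : X → M := fun x => e.toOpenPartialHomeomorph.symm (x, 1)
  let k : X → H := fun x => (e' (q (s x))).2
  let r : M' → M := fun m' =>
    e.toOpenPartialHomeomorph.symm (p' m', (k (p' m'))⁻¹ * (e' m').2)
  have hs : ∀ x ∈ e.baseSet, p (s x) = x := fun x hx => e.proj_symm_apply' hx
  have hqs' : ∀ x ∈ e.baseSet ∩ e'.baseSet, q (s x) ∈ e'.source := fun x hx => by
    rw [e'.mem_source, hqp, hs x hx.1]; exact hx.2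
  have hk : ContMDiffOn I K ω k (e.baseSet ∩ e'.baseSet) := by
    have h1 : ContMDiffOn I J ω s (e.baseSet ∩ e'.baseSet) :=
      he.holomorphic_symm.comp (contMDiff_id.prodMk contMDiff_const).contMDiffOn
        (fun x hx => e.mem_target.2 hx.1)
    exact contMDiff_snd.comp_contMDiffOn
      (he'.holomorphic.comp (hq.comp_contMDiffOn h1) hqs')
  have hr : ContMDiffOn J' J ω r (p' ⁻¹' (e.baseSet ∩ e'.baseSet)) := by
    have h1 : ContMDiffOn J' K ω (fun m' => k (p' m')) (p' ⁻¹' (e.baseSet ∩ e'.baseSet)) :=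
      hk.comp hp'.holomorphic_proj.contMDiffOn (fun _ h => h)
    have h2 : ContMDiffOn J' K ω (fun m' => (e' m').2) (p' ⁻¹' (e.baseSet ∩ e'.baseSet)) :=
      contMDiff_snd.comp_contMDiffOn
        (he'.holomorphic.mono fun m' h => e'.mem_source.2 h.2)
    exact he.holomorphic_symm.comp (hp'.holomorphic_proj.contMDiffOn.prodMk (h1.inv.mul h2))
      (fun m' h => e.mem_target.2 h.1)
  refine ⟨e.baseSet ∩ e'.baseSet, r, e.open_baseSet.inter e'.open_baseSet, ⟨hxe, hxe'⟩, hr,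
    fun m hm => ?_, fun m' hm' => ?_⟩
  · have h1 : (e' (q m)).2 = k (p m) * (e m).2 := by
      conv_lhs => rw [← he.smul_unit_point hp hm.1 rfl, hqs]
      rw [he'.equivariant _ (hqs' _ hm)]
    simp only [r]
    rw [hqp, h1, inv_mul_cancel_left]
    have hms : m ∈ e.source := e.mem_source.2 hm.1
    rw [← e.coe_fst hms]
    exact e.left_inv hms
  · have hm's : m' ∈ e'.source := e'.mem_source.2 hm'.2
    have h1 : r m' = op ((k (p' m'))⁻¹ * (e' m').2) • s (p' m') := by
      simp only [r, s]
      rw [he.smul_symm hp hm'.1, one_mul]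
    have h2 : q (r m') ∈ e'.source := by
      rw [e'.mem_source, hqp, h1, hp.proj_smul, hs _ hm'.1]; exact hm'.2
    apply e'.injOn h2 hm's
    change e' (q (r m')) = e' m'
    refine Prod.ext ?_ ?_
    · rw [e'.coe_fst h2, e'.coe_fst hm's, hqp, h1, hp.proj_smul, hs _ hm'.1]
    · rw [h1, hqs, he'.equivariant _ (hqs' _ hm')]
      exact mul_inv_cancel_left _ _

/-- A holomorphic equivariant map over the base between principal bundles is an isomorphism. -/
theorem equivariantlyIsomorphic_of_map (hp : IsPrincipalBundle I J K H p)
    (hp' : IsPrincipalBundle I J' K H p') {q : M → M'} (hq : ContMDiff J J' ω q)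
    (hqp : ∀ m, p' (q m) = p m) (hqs : ∀ (h : H) (m : M), q (op h • m) = op h • q m) :
    EquivariantlyIsomorphic J J' H p p' := by
  choose U r hU hxU hr hrq hqr using exists_local_inverse hp hp' hq hqp hqs
  have hbij : Function.Bijective q := by
    refine ⟨fun m₁ m₂ h => ?_, fun m' => ⟨r (p' m') m', hqr _ _ (hxU _)⟩⟩
    have h1 : p m₂ = p m₁ := by rw [← hqp, ← hqp, h]
    rw [← hrq (p m₁) m₁ (hxU _), ← hrq (p m₁) m₂ (by rw [h1]; exact hxU _), h]
  let Q : M ≃ M' := Equiv.ofBijective q hbij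
  refine ⟨⟨Q, hq, fun m' => ?_⟩, hqp, hqs⟩
  have hmem : p' ⁻¹' U (p' m') ∈ 𝓝 m' :=
    ((hU (p' m')).preimage hp'.holomorphic_proj.continuous).mem_nhds (hxU _)
  refine ((hr (p' m')).contMDiffAt hmem).congr_of_eventuallyEq ?_
  filter_upwards [hmem] with m'' h
  refine (Q.symm_apply_eq).2 ?_
  exact (hqr (p' m') m'' h).symm

end EquivariantMaps

section MultiplicativeGroup

variable {EX : Type uE} [NormedAddCommGroup EX] [NormedSpace ℂ EX]
  {HX : Type uH} [TopologicalSpace HX] {I : ModelWithCorners ℂ EX HX}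
  {X : Type uX} [TopologicalSpace X] [ChartedSpace HX X]
  {EM : Type*} [NormedAddCommGroup EM] [NormedSpace ℂ EM]
  {HM : Type*} [TopologicalSpace HM] {J : ModelWithCorners ℂ EM HM}
  {M : Type uM} [TopologicalSpace M] [ChartedSpace HM M]
  [MulAction ℂˣᵐᵒᵖ M] {p : M → X}

/-- If `M` maps equivariantly to `L^×`, then `L^{⊗ l}` is associated to `M` by the character
`c ↦ c ^ l`. -/
theorem zpow_holomorphicallyIsomorphic (hp : IsPrincipalBundle I J 𝓘(ℂ) ℂˣ p)
    (L : HolomorphicLineBundle.{uE, uH, uX, v} I X) {q : M → L.Punctured}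
    (hq : ContMDiff J (I.prod 𝓘(ℂ)) ω q) (hqp : ∀ m, L.puncturedProj (q m) = p m)
    (hqs : ∀ (c : ℂˣ) (m : M), q (op c • m) = op c • q m) (l : ℤ) :
    HolomorphicallyIsomorphic I ℂ (L.zpow l).Fiber ℂ
      (associatedLineBundle hp (zpowCharacter l)).Fiber := by
  have hmem : ∀ m x, p m = x →
      L.puncturedProj (q m) ∈ (trivializationAt ℂ L.Fiber x).baseSet := by
    rintro m _ rfl
    rw [hqp]
    exact FiberBundle.mem_baseSet_trivializationAt' _
  have hβ : IsEquivariantSection ℂ hp (zpowCharacter l)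
      (V := (L.zpow l).Fiber) (fun m x _ => L.power l (q m) x) := by
    refine ⟨?_, fun m x hx => ?_, fun m x hx c => ?_⟩
    · have h1 := (L.contMDiff_power l).comp hq
      refine h1.congr fun m => ?_
      -- The fibre over `p m` is only propositionally the fibre over the projection of `q m`.
      have hpt : ∀ x y, x = y → (⟨x, L.power l (q m) x⟩ : TotalSpace ℂ (L.zpow l).Fiber) =
          ⟨y, L.power l (q m) y⟩ := by
        rintro x _ rfl
        rfl
      exact hpt _ _ (hqp m).symm
    · exact zpow_ne_zero l (L.fiberCoord_ne_zero (q m) (hmem m x hx))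
    · rw [hqs]
      change (L.fiberCoord x (op c • q m).1 ^ l : ℂ) =
        (((zpowCharacter l) c : ℂˣ) : ℂ) * L.fiberCoord x (q m).1 ^ l
      rw [zpowCharacter_apply, Units.val_zpow_eq_zpow_val, ← mul_zpow]
      exact congrArg (· ^ l) (L.fiberCoord_smul (hmem m x hx) _ _)
  exact hβ.holomorphicallyIsomorphic (ℓ := ContinuousLinearMap.id ℂ ℂ) Function.injective_id

/-- The map `m ↦ [m, 1]` from a principal `ℂ^×`-bundle to the punctured total space of the line
bundle associated to it by the tautological character. -/
def toPunctured (hp : IsPrincipalBundle I J 𝓘(ℂ) ℂˣ p) (m : M) :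
    (associatedLineBundle hp (zpowCharacter 1)).Punctured :=
  ⟨AssocFiber.totalMk hp _ m 1, AssocFiber.fiberMk_ne_zero hp _ m rfl one_ne_zero⟩

theorem contMDiff_toPunctured (hp : IsPrincipalBundle I J 𝓘(ℂ) ℂˣ p) :
    ContMDiff J (I.prod 𝓘(ℂ)) ω (toPunctured hp) := fun _ =>
  HolomorphicLineBundle.contMDiffAt_punctured_iff.2
    (AssocFiber.contMDiffAt_totalMk hp _ contMDiffAt_id contMDiffAt_const)

theorem toPunctured_smul (hp : IsPrincipalBundle I J 𝓘(ℂ) ℂˣ p) (c : ℂˣ) (m : M) :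
    toPunctured hp (op c • m) = op c • toPunctured hp m := by
  apply Subtype.ext
  change AssocFiber.totalMk hp _ (op c • m) 1 =
    ⟨p m, (c : ℂ) • AssocFiber.fiberMk hp (zpowCharacter 1) m rfl 1⟩
  rw [AssocFiber.totalMk_eq hp _ (hp.proj_smul c m), AssocFiber.fiberMk_smul hp _ m rfl,
    AssocFiber.fiberMk_mul, zpowCharacter_apply, zpow_one]

variable [FiniteDimensional ℂ EX] [IsManifold I ω X] [FiniteDimensional ℂ EM] [IsManifold J ω M]

/-- A principal `ℂ^×`-bundle mapping equivariantly to `L^×` admits a CY structure if and only if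
the canonical bundle of the base is a power of `L`. -/
theorem admitsCYStructure_iff_zpow (hp : IsPrincipalBundle I J 𝓘(ℂ) ℂˣ p)
    (L : HolomorphicLineBundle.{uE, uH, uX, v} I X) {q : M → L.Punctured}
    (hq : ContMDiff J (I.prod 𝓘(ℂ)) ω q) (hqp : ∀ m, L.puncturedProj (q m) = p m)
    (hqs : ∀ (c : ℂˣ) (m : M), q (op c • m) = op c • q m) :
    AdmitsCYStructure J M 𝓘(ℂ) ℂˣ ↔ ∃ l : ℤ, CanonicalIso I (L.zpow l) := by
  rw [admitsCYStructure_iff hp]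
  constructor
  · rintro ⟨χ, hχ⟩
    obtain ⟨l, rfl⟩ := exists_eq_zpowCharacter χ
    exact ⟨l, HolomorphicallyIsomorphic.trans hχ
      (zpow_holomorphicallyIsomorphic hp L hq hqp hqs l).symm⟩
  · rintro ⟨l, hl⟩
    exact ⟨zpowCharacter l, HolomorphicallyIsomorphic.trans hl
      (zpow_holomorphicallyIsomorphic hp L hq hqp hqs l)⟩

end MultiplicativeGroup

end CYBundle

end

open CYBundle in
theorem theorem3p3
    {E : Type*} [NormedAddCommGroup E] [NormedSpace ℂ E] [FiniteDimensional ℂ E]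
    {X : Type*} [TopologicalSpace X] [ChartedSpace E X] [IsManifold 𝓘(ℂ, E) ω X] :
    -- a principal `H`-bundle `p : M → X` admits a CY structure iff `K_X ≅ M ×_H ℂ_χ` for some `χ`
    (∀ {EH : Type*} [NormedAddCommGroup EH] [NormedSpace ℂ EH] [FiniteDimensional ℂ EH]
      {H : Type*} [Group H] [TopologicalSpace H] [ChartedSpace EH H] [LieGroup 𝓘(ℂ, EH) ω H]
      {EM : Type*} [NormedAddCommGroup EM] [NormedSpace ℂ EM] [FiniteDimensional ℂ EM]
      {HM : Type*} [TopologicalSpace HM] (J : ModelWithCorners ℂ EM HM) [J.Boundaryless]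
      {M : Type*} [TopologicalSpace M] [ChartedSpace HM M] [IsManifold J ω M]
      [MulAction Hᵐᵒᵖ M] (p : M → X) (hp : IsPrincipalBundle 𝓘(ℂ, E) J 𝓘(ℂ, EH) H p),
      AdmitsCYStructure J M 𝓘(ℂ, EH) H ↔
        ∃ χ : HolomorphicCharacter 𝓘(ℂ, EH) H,
          CanonicalIso 𝓘(ℂ, E) (associatedLineBundle hp χ)) ∧
    -- `L^×` admits a CY structure iff `K_X` is a power of `L`
    (∀ L : HolomorphicLineBundle 𝓘(ℂ, E) X,
      AdmitsCYStructure (𝓘(ℂ, E).prod 𝓘(ℂ)) L.Punctured 𝓘(ℂ) ℂˣ ↔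
        ∃ l : ℤ, CanonicalIso 𝓘(ℂ, E) (L.zpow l)) ∧
    -- a principal `ℂ^×`-bundle admits a CY structure iff it is isomorphic to `L^×` for some line
    -- bundle `L` such that `K_X` is a power of `L`
    (∀ {EM : Type*} [NormedAddCommGroup EM] [NormedSpace ℂ EM] [FiniteDimensional ℂ EM]
      {HM : Type*} [TopologicalSpace HM] (J : ModelWithCorners ℂ EM HM) [J.Boundaryless]
      {M : Type uM} [TopologicalSpace M] [ChartedSpace HM M] [IsManifold J ω M]
      [MulAction ℂˣᵐᵒᵖ M] (p : M → X) (_ : IsPrincipalBundle 𝓘(ℂ, E) J 𝓘(ℂ) ℂˣ p),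
      AdmitsCYStructure J M 𝓘(ℂ) ℂˣ ↔
        ∃ L : HolomorphicLineBundle.{_, _, _, uM} 𝓘(ℂ, E) X,
          (∃ l : ℤ, CanonicalIso 𝓘(ℂ, E) (L.zpow l)) ∧
          EquivariantlyIsomorphic J (𝓘(ℂ, E).prod 𝓘(ℂ)) ℂˣ p L.puncturedProj) := by
  refine ⟨fun J _ _ _ _ _ _ p hp => ?_, fun L => ?_, fun J _ _ _ _ _ _ p hp => ?_⟩
  · exact admitsCYStructure_iff hp
  · exact admitsCYStructure_iff_zpow L.isPrincipalBundle_punctured L (q := id) contMDiff_id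
      (fun _ => rfl) (fun _ _ => rfl)
  -- For the third claim, `L` is the line bundle associated to `M` by the identity character.
  · refine ⟨fun h => ⟨associatedLineBundle hp (zpowCharacter 1), ?_, ?_⟩, ?_⟩
    · exact (admitsCYStructure_iff_zpow hp _ (contMDiff_toPunctured hp) (fun _ => rfl)
        (toPunctured_smul hp)).1 h
    · exact equivariantlyIsomorphic_of_map hp (HolomorphicLineBundle.isPrincipalBundle_punctured _)
        (contMDiff_toPunctured hp) (fun _ => rfl) (toPunctured_smul hp)
    · rintro ⟨L, ⟨l, hl⟩, Φ, h1, h2⟩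
      exact (admitsCYStructure_iff_zpow hp L (q := Φ) Φ.contMDiff h1 h2).2 ⟨l, hl⟩
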